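/- **Conventions.** Let $W$ be the Riemann surface of $\sqrt t$; on it $\arg t$ is defined modulo $4\pi$ and $\sqrt t$ is a single-valued holomorphic coordinate. For $d\in\mathbb R$, $\alpha,r>0$ let $S(d,\alpha,r)=\{t\in W: 0<|t|<r,\ |\arg t-d|<\alpha/2 \bmod 4\pi\}$, $W_r=\{t\in W:0<|t|<r\}$, $\mathcal L_d=\{t\in W:\arg t=d \bmod 4\pi\}$ and $D_\rho=\{z\in\mathbb C:|z|<\rho\}$. Consider the heat equation $\partial_tu=\partial_z^2u$, $u(0,z)=\varphi(z)$. Its formal solution is $\hat u=\sum_{n\ge0}\varphi^{(2n)}(z)t^n/n!$. An *actual solution* on $S\times D_\rho$ ($S\subseteq W$ a sector) is a holomorphic $u$ on $S\times D_\rho$ with $\partial_tu=\partial_z^2u$ there and $\lim_{t\to0,\,t\in S}u(t,z)=\varphi(z)$ for all $z\in D_\rho$. A formal series $\hat u=\sum a_n(z)t^n$ is *$1$-summable in the direction* $d\in\mathbb R$ if, for some disc $D_\rho$ and some $\varepsilon>0$, the $a_n$ are holomorphic on $D_\rho$ with $|a_n(z)|\le AB^nn!$ there, and $g(s,z)=\sum_n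 a_n(z)\,n!\,s^n/(2n)!$ continues analytically in $s$ from a neighbourhood of $0$ to the sector $|\arg s-d|<\varepsilon/2$, holomorphically in $(s,z)$, and with $|g(s,z)|\le C_1e^{C_2|s|}$ for $z\in D_\rho$ on each smaller sector $|\arg s-d|<\varepsilon'/2$, $\varepsilon'<\varepsilon$. Its *$1$-sum in the direction* $d$ is then $$t^{-1/2}\int_{e^{i\theta}\mathbb R_+}g(s,z)\,C_2\big((s/t)^{1/2}\big)\,d s^{1/2},\qquad C_2(\tau)=\sum_{n\ge0}\frac{(-\tau)^n}{n!\,\Gamma(1-\frac{n+1}{2})},$$ with $|\theta-d|<\varepsilon/2$, for $t\in S(\theta,\pi-\eta,r)$ ($\eta>0$ arbitrary, $r$ depending on $\eta$ and $\theta$) and $z\in D_\rho$. Directions in which $\hat u$ is not $1$-summable are *singular*; $\hat u$ is *$1$-summable* if there are only finitely many of them modulo $2\pi$. $\mathcal L_d$ is a *Stokes line* if $d$ is singular and all other directions near $d$ are not; then $\mathcal L_{d\pm\pi/2}$ are *anti-Stokes lines*, and the *jump* across $\mathcal L_d$ is $u^{d^+}-u^{d^-}$, the difference of the $1$-sums in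 directions slightly greater and slightly less than $d$ (continued analytically). A finite family $\{u_i\}$, $u_i$ holomorphic on $V_i\times D_\rho$, is a *maximal family of solutions on $W_r\times D_\rho$* if $\hat u$ is $1$-summable and: each $V_i\subseteq W_r$ is a sector of opening $>\pi$; the $V_i$ cover $W_r$; each $u_i$ is an actual solution on $V_i\times D_\rho$; if $i\ne j$ and $V_i\cap V_j\neq\emptyset$ then $u_i\not\equiv u_j$ on $(V_i\cap V_j)\times D_\rho$; and whenever $\tilde u$ is an actual solution on $\tilde V\times D_\rho$, with $\tilde V\subseteq W_r$ a sector, that is the $1$-sum of $\hat u$ in some nonsingular direction $d$ (that is, $\tilde V$ meets $\mathcal L_d$ and $\tilde u$ agrees with the $1$-sum near $\mathcal L_d$ for small $t$ and $z$), there is $i$ with $\tilde V\cap V_i\ne\emptyset$ and $\tilde u\equiv u_i$ on $(\tilde V\cap V_i)\times D_\rho$. **Theorem.** Let $\varphi(z)=\dfrac{a}{z-z_0}+\tilde\varphi(z)$ with $a,z_0\in\mathbb C\setminus\{0\}$ and $\tilde\varphi$ entire with $|\tilde\varphi(z)|\le C_1e^{C_2|z|^2}$ for some $C_1,C_2>0$.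 Let $\hat u$ be the formal solution and $\delta=2\arg z_0$. Then there are functions $u_1,u_2$ with the following properties. 1. For every $\theta\in(\delta,\delta+2\pi)$ modulo $4\pi$ (resp. $\theta\in(\delta+2\pi,\delta+4\pi)$ modulo $4\pi$), $u_1$ (resp. $u_2$) is the $1$-sum of $\hat u$ in the direction $\theta$ and equals $$u^\theta(t,z)=\frac1{\sqrt{4\pi t}}\int_{e^{i\theta/2}\mathbb R_+}\big(\varphi(z+s)+\varphi(z-s)\big)e^{-s^2/(4t)}\,ds$$ on $S(\theta,\pi-\eta,r')\times D_{\rho'}$, for every $\eta\in(0,\pi)$ and suitable $r',\rho'>0$ depending on $\eta$ and $\theta$. 2. For every $\varepsilon\in(0,\pi)$ there are $r>0$ and $\rho_0>0$ such that for every $\rho\in(0,\rho_0]$, with $V_1=S(\delta+\pi,3\pi-\varepsilon,r)$, $V_2=S(\delta+3\pi,3\pi-\varepsilon,r)$ and $D=D_\rho$: $u_l$ is holomorphic on $V_l\times D$ ($l=1,2$); $\{u_1,u_2\}$ is a maximal family of solutions on $W_r\times D$; and the jumps across $\mathcal L_\delta$ and $\mathcal L_{\delta+2\pi}$ are $$u_1-u_2=u^{\delta^+}-u^{\delta^-}=-i\sqrt{\pi/t}\;a\,e^{-\frac{(z_0-z)^2}{4t}}\quad\text{on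 }S(\delta,\pi-\varepsilon,r)\times D,$$ $$u_2-u_1=u^{(\delta+2\pi)^+}-u^{(\delta+2\pi)^-}=i\sqrt{\pi/t}\;a\,e^{-\frac{(z_0-z)^2}{4t}}\quad\text{on }S(\delta+2\pi,\pi-\varepsilon,r)\times D.$$ 3. The Stokes lines for $\hat u$ are exactly $\mathcal L_\delta$ and $\mathcal L_{\delta+2\pi}$, and the anti-Stokes lines are exactly $\mathcal L_{\delta\pm\pi/2}$ and $\mathcal L_{\delta+2\pi\pm\pi/2}$. -/

import Mathlib

open Set Filter Topology MeasureTheory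

noncomputable section

namespace HeatStokes

/-! ### The Riemann surface of the square root

The Riemann surface `W` of `√t` is the punctured plane `ℂ ∖ {0}` with its global coordinate
`w = √t`: the point `w` lies above `t = w ^ 2`, and the argument of `t`, which on `W` is defined
modulo `4π`, is twice the argument of `w`. Functions on `W × ℂ` are written as functions
`u : ℂ → ℂ → ℂ` of `w` and `z`; only the values at `w ≠ 0` matter. -/

/-- The point of `W` with `|t| = x` and `arg t = φ`, in the coordinate `w = √t`. -/
def surfacePoint (x φ : ℝ) : ℂ :=
  (Real.sqrt x : ℂ) * Complex.exp (Complex.I * (φ / 2 : ℝ))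

/-- The sector `S(d, α, R)` on `W`: the points `t` with `0 < |t| < R` and
`arg t ∈ (d - α/2, d + α/2)` (modulo `4π`). -/
def sector (d α R : ℝ) : Set ℂ :=
  {w | ∃ x φ : ℝ, 0 < x ∧ x < R ∧ |φ - d| < α / 2 ∧ w = surfacePoint x φ}

/-- `W_r`: the points of `W` with `0 < |t| < r`. -/
def surfaceDisc (r : ℝ) : Set ℂ := {w | 0 < ‖w ^ 2‖ ∧ ‖w ^ 2‖ < r}

/-- The line `𝓛_φ`: the points of `W` with `arg t = φ` (modulo `4π`). -/
def line (φ : ℝ) : Set ℂ := {w | ∃ x : ℝ, 0 < x ∧ w = surfacePoint x φ}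

/-- The disc `D_ρ`. -/
def disc (ρ : ℝ) : Set ℂ := Metric.ball 0 ρ

/-- `u ∈ 𝒪(V × D_ρ)`. As `w` is a local coordinate of `W`, holomorphy on `W` is holomorphy
in `w`. -/
def IsHolomorphicOn (u : ℂ → ℂ → ℂ) (V : Set ℂ) (ρ : ℝ) : Prop :=
  DifferentiableOn ℂ (fun p : ℂ × ℂ => u p.1 p.2) (V ×ˢ disc ρ)

/-- Entire functions of exponential growth of order at most `2`. -/
def IsEntireOfOrderTwo (f : ℂ → ℂ) : Prop :=
  Differentiable ℂ f ∧ ∃ C₁ C₂ : ℝ, 0 < C₁ ∧ 0 < C₂ ∧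
    ∀ z, ‖f z‖ ≤ C₁ * Real.exp (C₂ * ‖z‖ ^ 2)

/-! ### 1-summability of formal power series

A formal power series `∑ aₙ(z) tⁿ` is the sequence `a : ℕ → ℂ → ℂ` of its coefficients, which
are functions holomorphic near `z = 0`. The discs in `z` may be shrunk. -/

/-- The open unbounded sector `S(d, ε)` in the plane of the Borel variable `s`. -/
def borelSector (d ε : ℝ) : Set ℂ :=
  {s | ∃ x φ : ℝ, 0 < x ∧ |φ - d| < ε / 2 ∧ s = x * Complex.exp (Complex.I * φ)}

/-- The series has holomorphic coefficients on `D_ρ` and is of Gevrey order `1` there. -/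
def IsGevreyOne (a : ℕ → ℂ → ℂ) (ρ : ℝ) : Prop :=
  (∀ n, DifferentiableOn ℂ (a n) (disc ρ)) ∧
  ∃ A B : ℝ, 0 < A ∧ 0 < B ∧ ∀ n, ∀ z ∈ disc ρ, ‖a n z‖ ≤ A * B ^ n * (n.factorial : ℝ)

/-- `g` is the modified Borel transform `∑ aₙ(z) n! sⁿ / Γ(1 + 2n)` of order `1`, continued
analytically to `S(d, ε)` with exponential growth of order at most `1`, uniformly for
`z ∈ D_ρ`. (`S(d, ε')` with `ε' < ε` runs through a cofinal family of proper subsectors.) -/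
structure IsBorelTransform (a : ℕ → ℂ → ℂ) (d ε ρ : ℝ) (g : ℂ → ℂ → ℂ) : Prop where
  gevrey : IsGevreyOne a ρ
  near_zero : ∃ R : ℝ, 0 < R ∧
    (∀ s : ℂ, ‖s‖ < R → ∀ z ∈ disc ρ,
      HasSum (fun n : ℕ =>
        a n z * (n.factorial : ℂ) / Complex.Gamma (1 + 2 * (n : ℂ)) * s ^ n) (g s z)) ∧
    IsHolomorphicOn g (Metric.ball 0 R ∪ borelSector d ε) ρ
  growth : ∀ ε' : ℝ, 0 < ε' → ε' < ε → ∃ C₁ C₂ : ℝ, 0 < C₁ ∧ 0 < C₂ ∧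
    ∀ s ∈ borelSector d ε', ∀ z ∈ disc ρ, ‖g s z‖ ≤ C₁ * Real.exp (C₂ * ‖s‖)

/-- `1`-summability in the direction `d`. -/
def IsSummableInDirection (a : ℕ → ℂ → ℂ) (d : ℝ) : Prop :=
  ∃ ε ρ : ℝ, 0 < ε ∧ 0 < ρ ∧ ∃ g, IsBorelTransform a d ε ρ g

/-- The function `C_α(τ) = ∑ (-τ)ⁿ / (n! Γ(1 - (n+1)/α))`. At a pole of `Γ` the term is `0`;
Lean agrees, since there `Complex.Gamma` is `0` and division by `0` gives `0`. -/
def ecalleKernel (α : ℝ) (τ : ℂ) : ℂ :=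
  ∑' n : ℕ, (-τ) ^ n / ((n.factorial : ℂ) * Complex.Gamma (1 - ((n : ℂ) + 1) / (α : ℂ)))

/-- The integrand of the Ecalle operator of order `1`
`t^{-1/2} ∫ g(s) C₂((s/t)^{1/2}) d s^{1/2}` along the ray `s = x² e^{iθ}`, so that
`s^{1/2} = x e^{iθ/2}`, at the point `w = t^{1/2}` of `W`. -/
def ecalleIntegrand (g : ℂ → ℂ → ℂ) (θ : ℝ) (w z : ℂ) (x : ℝ) : ℂ :=
  g ((x : ℂ) ^ 2 * Complex.exp (Complex.I * θ)) z *
    ecalleKernel 2 (x * Complex.exp (Complex.I * (θ / 2 : ℝ)) / w) *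
    Complex.exp (Complex.I * (θ / 2 : ℝ))

/-- `u` is the `1`-sum of the series in the direction `d`: it is given by the Ecalle operator
applied to the Borel transform, with integration along any ray of direction `θ` close to `d`,
where the ray of direction `θ` yields `u` on `S(θ, π - η, r) × D_ρ`. -/
def IsOneSum (a : ℕ → ℂ → ℂ) (d : ℝ) (u : ℂ → ℂ → ℂ) : Prop :=
  ∃ ε ρ : ℝ, 0 < ε ∧ 0 < ρ ∧ ∃ g, IsBorelTransform a d ε ρ g ∧
    ∀ θ : ℝ, |θ - d| < ε / 2 → ∀ η : ℝ, 0 < η → η < Real.pi → ∃ r : ℝ, 0 < r ∧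
      ∀ w ∈ sector θ (Real.pi - η) r, ∀ z ∈ disc ρ,
        IntegrableOn (ecalleIntegrand g θ w z) (Ioi 0) ∧
        u w z = w⁻¹ * ∫ x in Ioi (0 : ℝ), ecalleIntegrand g θ w z x

/-- `1`-summability: in all directions but, modulo `2π`, finitely many. -/
def IsOneSummable (a : ℕ → ℂ → ℂ) : Prop :=
  ∃ F : Finset ℝ, ∀ d : ℝ, ¬ IsSummableInDirection a d →
    ∃ f ∈ F, ∃ k : ℤ, d = f + 2 * Real.pi * k

/-! ### The Stokes phenomenon -/

/-- `φ` is a singular direction, and all other directions close to `φ` are not. -/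
def IsStokesDirection (a : ℕ → ℂ → ℂ) (φ : ℝ) : Prop :=
  ¬ IsSummableInDirection a φ ∧
  ∃ ε : ℝ, 0 < ε ∧ ∀ d ∈ Ioo (φ - ε) (φ + ε), d ≠ φ → IsSummableInDirection a d

/-- The Stokes lines, as subsets of `W`. -/
def stokesLines (a : ℕ → ℂ → ℂ) : Set (Set ℂ) :=
  {L | ∃ φ : ℝ, IsStokesDirection a φ ∧ L = line φ}

/-- The anti-Stokes lines, as subsets of `W`. -/
def antiStokesLines (a : ℕ → ℂ → ℂ) : Set (Set ℂ) :=
  {L | ∃ φ : ℝ, IsStokesDirection a φ ∧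
    (L = line (φ + Real.pi / 2) ∨ L = line (φ - Real.pi / 2))}

/-- On `S(φ, α, r) × D_ρ` the function `J` is the jump `u^{φ⁺} - u^{φ⁻}` across the Stokes line
`𝓛_φ`: the difference of the `1`-sums in the directions slightly greater and slightly less
than `φ`, continued analytically to `S(φ, α, r) × D_ρ`. -/
def IsJump (a : ℕ → ℂ → ℂ) (φ α r ρ : ℝ) (J : ℂ → ℂ → ℂ) : Prop :=
  IsStokesDirection a φ ∧ ∃ up um : ℂ → ℂ → ℂ,
    IsHolomorphicOn up (sector φ α r) ρ ∧ IsHolomorphicOn um (sector φ α r) ρ ∧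
    (∃ η : ℝ, 0 < η ∧ (∀ d ∈ Ioo φ (φ + η), IsOneSum a d up) ∧
      (∀ d ∈ Ioo (φ - η) φ, IsOneSum a d um)) ∧
    ∀ w ∈ sector φ α r, ∀ z ∈ disc ρ, up w z - um w z = J w z

/-! ### The heat equation -/

/-- `∑ aₙ(z) tⁿ` is a formal solution of `∂ₜ u = ∂_z² u`, `u(0, z) = φ(z)`. -/
def IsFormalSolution (φ : ℂ → ℂ) (a : ℕ → ℂ → ℂ) : Prop :=
  ∃ ρ : ℝ, 0 < ρ ∧ (∀ n, DifferentiableOn ℂ (a n) (disc ρ)) ∧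
    (∀ z ∈ disc ρ, a 0 z = φ z) ∧
    ∀ n : ℕ, ∀ z ∈ disc ρ, ((n : ℂ) + 1) * a (n + 1) z = iteratedDeriv 2 (a n) z

/-- `u ∈ 𝒪(S × D_ρ)` is an actual solution. In the coordinate `w` of `W` the derivative `∂ₜ` is
`(2 w)⁻¹ ∂_w`. -/
structure IsActualSolution (φ : ℂ → ℂ) (S : Set ℂ) (ρ : ℝ) (u : ℂ → ℂ → ℂ) : Prop where
  holomorphic : IsHolomorphicOn u S ρ
  equation : ∀ w ∈ S, ∀ z ∈ disc ρ,
    (2 * w)⁻¹ * deriv (fun w' => u w' z) w = iteratedDeriv 2 (fun z' => u w z') z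
  initial : ∀ z ∈ disc ρ, Tendsto (fun w => u w z) (𝓝[S] 0) (𝓝 (φ z))

/-- The integrand of `∫ (φ(z+s) + φ(z-s)) e^{-s²/(4t)} ds` along the ray `s = x e^{iθ/2}`. -/
def heatIntegrand (φ : ℂ → ℂ) (θ : ℝ) (w z : ℂ) (x : ℝ) : ℂ :=
  (φ (z + x * Complex.exp (Complex.I * (θ / 2 : ℝ))) +
      φ (z - x * Complex.exp (Complex.I * (θ / 2 : ℝ)))) *
    Complex.exp (-(x * Complex.exp (Complex.I * (θ / 2 : ℝ))) ^ 2 / (4 * w ^ 2)) *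
    Complex.exp (Complex.I * (θ / 2 : ℝ))

/-- `u` is the solution `u^θ`: for every `η` there are `r` and `ρ` such that on
`S(θ, π - η, r) × D_ρ` it is `(4πt)^{-1/2} ∫ (φ(z+s) + φ(z-s)) e^{-s²/(4t)} ds`, with
integration along the ray `e^{iθ/2} ℝ₊`. -/
def IsHeatIntegral (φ : ℂ → ℂ) (θ : ℝ) (u : ℂ → ℂ → ℂ) : Prop :=
  ∀ η : ℝ, 0 < η → η < Real.pi → ∃ r ρ : ℝ, 0 < r ∧ 0 < ρ ∧
    ∀ w ∈ sector θ (Real.pi - η) r, ∀ z ∈ disc ρ,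
      IntegrableOn (heatIntegrand φ θ w z) (Ioi 0) ∧
      u w z = (2 * (Real.sqrt Real.pi : ℂ) * w)⁻¹ *
        ∫ x in Ioi (0 : ℝ), heatIntegrand φ θ w z x

/-- A sector on `W`. (A sector of opening greater than `4π` covers a whole punctured disc.) -/
def IsSector (V : Set ℂ) : Prop :=
  ∃ d α R : ℝ, 0 < α ∧ 0 < R ∧ V = sector d α R

/-- A sector on `W` of opening greater than `π`. -/
def IsWideSector (V : Set ℂ) : Prop :=
  ∃ d α R : ℝ, Real.pi < α ∧ 0 < R ∧ V = sector d α R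

/-- On the sector `V`, which contains points of direction `d`, the function `u` is the `1`-sum
in the direction `d`: it agrees with the `1`-sum near the line `𝓛_d` for small `t` and `z`
(and hence, being holomorphic, is its analytic continuation). -/
def IsOneSumOn (a : ℕ → ℂ → ℂ) (d : ℝ) (V : Set ℂ) (u : ℂ → ℂ → ℂ) : Prop :=
  (V ∩ line d).Nonempty ∧ ∃ s : ℂ → ℂ → ℂ, IsOneSum a d s ∧
    ∃ η r ρ : ℝ, 0 < η ∧ 0 < r ∧ 0 < ρ ∧
      ∀ w ∈ V ∩ sector d η r, ∀ z ∈ disc ρ, u w z = s w z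

/-- `{uᵢ}` with `uᵢ ∈ 𝒪(Vᵢ × D_ρ)` is a maximal family of solutions on `V × D_ρ`, where `V` is a
sector on `W`. -/
structure IsMaximalFamily {ι : Type} [Finite ι] (φ : ℂ → ℂ) (a : ℕ → ℂ → ℂ) (V : Set ℂ) (ρ : ℝ)
    (Vs : ι → Set ℂ) (u : ι → ℂ → ℂ → ℂ) : Prop where
  formal : IsFormalSolution φ a
  summable : IsOneSummable a
  wide : IsWideSector V
  wide_sub : ∀ i, IsWideSector (Vs i) ∧ Vs i ⊆ V
  cover : V ⊆ ⋃ i, Vs i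
  solution : ∀ i, IsActualSolution φ (Vs i) ρ (u i)
  distinct : ∀ i j, i ≠ j → (Vs i ∩ Vs j).Nonempty →
    ∃ w ∈ Vs i ∩ Vs j, ∃ z ∈ disc ρ, u i w z ≠ u j w z
  maximal : ∀ (V' : Set ℂ) (u' : ℂ → ℂ → ℂ) (d : ℝ), IsSector V' → V' ⊆ V →
    IsActualSolution φ V' ρ u' → IsSummableInDirection a d → IsOneSumOn a d V' u' →
    ∃ i, (V' ∩ Vs i).Nonempty ∧ ∀ w ∈ V' ∩ Vs i, ∀ z ∈ disc ρ, u' w z = u i w z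

end HeatStokes

end

open HeatStokes

/-!
The solution is split along `φ = a / (z - z₀) + φt`, and everything is written in the coordinate
`w = √t` of `W`.

*Entire part.* Cauchy's estimates on circles of radius `√(n + 1)` show that the formal solution
`∑ φt⁽²ⁿ⁾(z) tⁿ / n!` converges for small `t`: it is a genuine solution `entireSol`, holomorphic at
`t = 0`. Integrating the even Taylor series of `φt` term by term against a Gaussian
(`IsEntireOfOrderTwo.exists_integral_eq_entireSol`) shows that every heat integral, in whatever
direction, is equal to it.

*Polar part.* With `q = (z₀ - z) / w`, the heat integral of the pole is a multiple of the Cauchy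
integral `∫₀^∞ 2q / (v² - q²) exp (-v² / 4) dv` along a ray. As a function of `q` this solves
`K' = -(q / 2) K - √π`, so it is `exp (-q² / 4) (± iπ - √π ∫₀^q exp (p² / 4) dp)`, an entire function
whose sign depends only on the side of the pole on which the ray runs (`poleKernel`,
`integral_pole_gaussian`). The two signs give `u₁` and `u₂`. Both are therefore holomorphic on a full
punctured disc of `W`, the heat equation is a direct computation, and the jump is the difference of
the two constants `± iπ`. The initial value is the first term of the asymptotic expansion of the
Cauchy integral along a fixed ray (`tendsto_poleSol`); three rays serve for a sector of opening
`3π - ε`.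

*Summability.* The Ecalle kernel of order `1` is the Gaussian `exp (-τ² / 4) / √π`, so the `1`-sum is
the heat integral of the Borel transform `(φ(z + σ) + φ(z - σ)) / 2`, `s = σ²` (`heatBorel`). Its
only singularity is the pole at `s = (z₀ - z)²`, which makes exactly the directions `δ + 2πk` singular
(`isBorelTransform_heatBorel`, `not_isSummableInDirection`).

*Maximality.* A solution on a sector which is a `1`-sum near one line coincides, by the identity
theorem first in `w` and then in `z`, with `u₁` or `u₂` on its whole domain, since these are
holomorphic there (`IsOneSumOn.eqOn`).
-/

noncomputable section

namespace HeatStokes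

/-- Weierstrass' theorem for a domain in an arbitrary complex normed space; the derivatives are
bounded by the Schwarz lemma. It gives joint holomorphy of series in two variables. -/
theorem differentiableOn_tsum_of_norm_le {E : Type*} [NormedAddCommGroup E] [NormedSpace ℂ E]
    {U : Set E} (hU : IsOpen U) {F : ℕ → E → ℂ} {b : ℕ → ℝ} (hb : Summable b)
    (hF : ∀ n, DifferentiableOn ℂ (F n) U) (hle : ∀ n, ∀ p ∈ U, ‖F n p‖ ≤ b n) :
    DifferentiableOn ℂ (fun p => ∑' n, F n p) U := by
  intro p hp
  obtain ⟨R, hR, hRU⟩ := Metric.isOpen_iff.1 hU p hp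
  have hball : ∀ x ∈ Metric.ball p (R / 2), Metric.ball x (R / 2) ⊆ U := by
    intro x hx y hy
    apply hRU
    have := dist_triangle y x p
    simp only [Metric.mem_ball] at *
    linarith
  have hsub : Metric.ball p (R / 2) ⊆ U := hball p (Metric.mem_ball_self (by linarith))
  have hd : ∀ n, ∀ x ∈ Metric.ball p (R / 2), HasFDerivAt (F n) (fderiv ℂ (F n) x) x :=
    fun n x hx => ((hF n).differentiableAt (hU.mem_nhds (hsub hx))).hasFDerivAt
  have hbd : ∀ n, ∀ x ∈ Metric.ball p (R / 2), ‖fderiv ℂ (F n) x‖ ≤ (2 * b n) / (R / 2) := by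
    intro n x hx
    refine Complex.norm_fderiv_le_div_of_mapsTo_ball ((hF n).mono (hball x hx)) ?_ (by linarith)
    intro y hy
    have h1 := hle n y (hball x hx hy)
    have h2 := hle n x (hsub hx)
    have := norm_sub_le (F n y) (F n x)
    simp only [Metric.mem_closedBall, dist_eq_norm]
    linarith
  have hs : Summable fun n => (2 * b n) / (R / 2) := (hb.mul_left 2).div_const _
  have hp' : p ∈ Metric.ball p (R / 2) := Metric.mem_ball_self (by linarith)
  have := hasFDerivAt_tsum_of_isPreconnected hs Metric.isOpen_ball
    (convex_ball p (R / 2)).isPreconnected hd hbd hp'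
    (Summable.of_norm_bounded hb fun n => hle n p hp) hp'
  exact this.differentiableAt.differentiableWithinAt

/-- The even part of `f` around `z`, as a power series in the square of the increment. -/
theorem hasSum_even_taylor {f : ℂ → ℂ} {z σ : ℂ} {R : ℝ}
    (hf : DifferentiableOn ℂ f (Metric.ball z R)) (hσ : ‖σ‖ < R) :
    HasSum (fun n : ℕ => iteratedDeriv (2 * n) f z / ((2 * n).factorial : ℂ) * (σ ^ 2) ^ n)
      ((f (z + σ) + f (z - σ)) / 2) := by
  have h1 := Complex.hasSum_taylorSeries_on_ball hf (z := z + σ) (by simpa using hσ)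
  have h2 := Complex.hasSum_taylorSeries_on_ball hf (z := z - σ) (by simpa using hσ)
  have h3 := (h1.add h2).div_const 2
  have hinj : Function.Injective (fun n : ℕ => 2 * n) := fun a b h => by simpa using h
  refine ((hinj.hasSum_iff ?_).2 h3).congr_fun ?_
  · intro n hn
    have hodd : Odd n := by
      by_contra h
      rw [Nat.not_odd_iff_even] at h
      obtain ⟨m, rfl⟩ := h
      exact hn ⟨m, by simp; ring⟩
    simp only [add_sub_cancel_left, sub_sub_cancel_left, hodd.neg_pow, smul_eq_mul]
    ring
  · intro n
    simp only [Function.comp, add_sub_cancel_left, sub_sub_cancel_left,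
      (even_two_mul n).neg_pow, smul_eq_mul, pow_mul]
    ring

/-! ### Sectors on the Riemann surface and in the Borel plane -/

theorem surfacePoint_eq_exp {x : ℝ} (hx : 0 < x) (φ : ℝ) :
    surfacePoint x φ = Complex.exp ((Real.log x / 2 : ℝ) + (φ / 2 : ℝ) * Complex.I) := by
  rw [surfacePoint, Complex.exp_add, ← Complex.ofReal_exp, Real.sqrt_eq_rpow,
    Real.rpow_def_of_pos hx, mul_comm Complex.I]
  congr 4
  ring

theorem norm_surfacePoint_sq {x : ℝ} (hx : 0 < x) (φ : ℝ) : ‖surfacePoint x φ‖ ^ 2 = x := by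
  rw [surfacePoint, norm_mul, mul_comm Complex.I, Complex.norm_exp_ofReal_mul_I, mul_one,
    Complex.norm_real, Real.norm_eq_abs, sq_abs, Real.sq_sqrt hx.le]

theorem surfacePoint_ne_zero {x : ℝ} (hx : 0 < x) (φ : ℝ) : surfacePoint x φ ≠ 0 := by
  intro h
  have := norm_surfacePoint_sq hx φ
  rw [h] at this
  simp at this
  linarith

theorem exp_eq_surfacePoint (v : ℂ) :
    Complex.exp v = surfacePoint (Real.exp (2 * v.re)) (2 * v.im) := by
  rw [surfacePoint_eq_exp (Real.exp_pos _), Real.log_exp]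
  congr 1
  apply Complex.ext <;> simp

/-- In the coordinate `log w`, a sector on `W` is a convex set; hence it is open and connected. -/
theorem sector_eq_image_exp (d α : ℝ) {R : ℝ} (hR : 0 < R) :
    sector d α R = Complex.exp ''
      (Complex.re ⁻¹' Iio (Real.log R / 2) ∩
        Complex.im ⁻¹' Ioo (d / 2 - α / 4) (d / 2 + α / 4)) := by
  ext w
  constructor
  · rintro ⟨x, φ, hx, hxR, hφ, rfl⟩
    refine ⟨_, ⟨?_, ?_⟩, (surfacePoint_eq_exp hx φ).symm⟩
    · have := Real.log_lt_log hx hxR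
      simp only [mem_preimage, Complex.add_re, Complex.ofReal_re, Complex.mul_re, Complex.I_re,
        Complex.ofReal_im, Complex.I_im, mem_Iio]
      linarith
    · rw [abs_lt] at hφ
      simp only [mem_preimage, Complex.add_im, Complex.ofReal_re, Complex.mul_im, Complex.I_re,
        Complex.ofReal_im, Complex.I_im, mem_Ioo]
      constructor <;> linarith
  · rintro ⟨v, ⟨h1, h2⟩, rfl⟩
    simp only [mem_preimage, mem_Iio, mem_Ioo] at h1 h2
    refine ⟨_, _, Real.exp_pos (2 * v.re), ?_, ?_, exp_eq_surfacePoint v⟩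
    · rw [← Real.lt_log_iff_exp_lt hR]; linarith
    · rw [abs_lt]; constructor <;> linarith

theorem isOpen_sector (d α : ℝ) {R : ℝ} (hR : 0 < R) : IsOpen (sector d α R) := by
  rw [sector_eq_image_exp d α hR]
  exact Complex.isOpenMap_exp _ ((isOpen_Iio.preimage Complex.continuous_re).inter
    (isOpen_Ioo.preimage Complex.continuous_im))

theorem isPreconnected_sector (d α : ℝ) {R : ℝ} (hR : 0 < R) :
    IsPreconnected (sector d α R) := by
  rw [sector_eq_image_exp d α hR]
  refine IsPreconnected.image (Convex.isPreconnected ?_) _ Complex.continuous_exp.continuousOn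
  exact ((convex_Iio _).linear_preimage Complex.reLm).inter
    ((convex_Ioo _ _).linear_preimage Complex.imLm)

theorem isOpen_borelSector (d ε : ℝ) : IsOpen (borelSector d ε) := by
  have : borelSector d ε = Complex.exp '' (Complex.im ⁻¹' Ioo (d - ε / 2) (d + ε / 2)) := by
    ext s
    constructor
    · rintro ⟨x, φ, hx, hφ, rfl⟩
      rw [abs_lt] at hφ
      refine ⟨(Real.log x : ℝ) + φ * Complex.I, ?_, ?_⟩
      · simp only [mem_preimage, Complex.add_im, Complex.ofReal_re, Complex.mul_im, Complex.I_re,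
          Complex.ofReal_im, Complex.I_im, mem_Ioo]
        constructor <;> linarith
      · rw [Complex.exp_add, ← Complex.ofReal_exp, Real.exp_log hx, mul_comm Complex.I]
    · rintro ⟨v, hv, rfl⟩
      simp only [mem_preimage, mem_Ioo] at hv
      refine ⟨Real.exp v.re, v.im, Real.exp_pos _, ?_, ?_⟩
      · rw [abs_lt]; constructor <;> linarith
      · rw [Complex.ofReal_exp, ← Complex.exp_add, mul_comm Complex.I, Complex.re_add_im]
  rw [this]
  exact Complex.isOpenMap_exp _ (isOpen_Ioo.preimage Complex.continuous_im)

theorem isPreconnected_ball_union_borelSector (d ε : ℝ) {R : ℝ} (hR : 0 < R) :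
    IsPreconnected (Metric.ball (0 : ℂ) R ∪ borelSector d ε) := by
  have h0 : (0 : ℂ) ∈ Metric.ball (0 : ℂ) R := Metric.mem_ball_self hR
  have hst : StarConvex ℝ (0 : ℂ) (Metric.ball (0 : ℂ) R ∪ borelSector d ε) := by
    rw [starConvex_zero_iff]
    rintro s (hs | ⟨x, φ, hx, hφ, rfl⟩) t ht0 ht1
    · left
      exact ((convex_ball (0 : ℂ) R).starConvex h0).smul_mem hs ht0 ht1
    · rcases ht0.eq_or_lt with rfl | ht0
      · left; simpa using hR
      · right
        exact ⟨t * x, φ, by positivity, hφ, by simp; ring⟩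
  exact (hst.isPathConnected (Or.inl h0)).isConnected.isPreconnected

theorem sector_subset_sector {d α R d' α' R' : ℝ} (h1 : d' - α' / 2 ≤ d - α / 2)
    (h2 : d + α / 2 ≤ d' + α' / 2) (hR : R ≤ R') : sector d α R ⊆ sector d' α' R' := by
  rintro w ⟨x, φ, hx, hxR, hφ, rfl⟩
  rw [abs_lt] at hφ
  exact ⟨x, φ, hx, hxR.trans_le hR, abs_lt.2 ⟨by linarith, by linarith⟩, rfl⟩

theorem sector_subset_surfaceDisc (d α R : ℝ) : sector d α R ⊆ surfaceDisc R := by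
  rintro w ⟨x, φ, hx, hxR, hφ, rfl⟩
  simp only [surfaceDisc, mem_ofPred_eq, norm_pow, norm_surfacePoint_sq hx]
  exact ⟨hx, hxR⟩

theorem surfacePoint_add_four_pi (x φ : ℝ) (k : ℤ) :
    surfacePoint x (φ + 4 * Real.pi * k) = surfacePoint x φ := by
  rw [surfacePoint, surfacePoint]
  congr 1
  rw [Complex.exp_eq_exp_iff_exists_int]
  exact ⟨k, by push_cast; ring⟩

/-- Every point of `W` has an argument in any prescribed interval of length `4π`. -/
theorem exists_surfacePoint_eq (w : ℂ) (d : ℝ) :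
    ∃ φ ∈ Ico d (d + 4 * Real.pi), w = surfacePoint (‖w‖ ^ 2) φ := by
  have hpi : (0 : ℝ) < 4 * Real.pi := by positivity
  refine ⟨toIcoMod hpi d (2 * w.arg), toIcoMod_mem_Ico hpi d _, ?_⟩
  have h : toIcoMod hpi d (2 * w.arg) =
      2 * w.arg + 4 * Real.pi * ((-toIcoDiv hpi d (2 * w.arg) : ℤ) : ℝ) := by
    rw [toIcoMod, zsmul_eq_mul]; push_cast; ring
  rw [h, surfacePoint_add_four_pi, surfacePoint, Real.sqrt_sq (norm_nonneg _)]
  conv_lhs => rw [← Complex.norm_mul_exp_arg_mul_I w]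
  rw [mul_comm Complex.I, mul_div_cancel_left₀ _ two_ne_zero]

/-- The unit vector `e^{iθ/2}`, the direction of the line `𝓛_θ` in the coordinate `w = √t`. -/
def halfDir (θ : ℝ) : ℂ := Complex.exp (Complex.I * (θ / 2 : ℝ))

theorem norm_halfDir (θ : ℝ) : ‖halfDir θ‖ = 1 := by
  rw [halfDir, mul_comm, Complex.norm_exp_ofReal_mul_I]

theorem halfDir_ne_zero (θ : ℝ) : halfDir θ ≠ 0 := Complex.exp_ne_zero _

theorem halfDir_sq (θ : ℝ) : halfDir θ ^ 2 = Complex.exp (Complex.I * θ) := by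
  rw [halfDir, ← Complex.exp_nat_mul]; congr 1; push_cast; ring

theorem continuous_halfDir : Continuous halfDir := by unfold halfDir; fun_prop

theorem halfDir_add_four_pi (θ : ℝ) (k : ℤ) : halfDir (θ + 4 * Real.pi * k) = halfDir θ := by
  have := surfacePoint_add_four_pi 1 θ k
  simpa [surfacePoint, halfDir] using this

/-- On the sector of opening less than `π` around the direction `θ`, the Gaussian
`exp (-s² / (4w²))` decays along the ray of direction `e^{iθ/2}`, with explicit rate. -/
theorem re_halfDir_div {θ η r : ℝ} (hη : 0 < η) (hη' : η < Real.pi) {w : ℂ}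
    (hw : w ∈ sector θ (Real.pi - η) r) :
    w ≠ 0 ∧ ‖w‖ ^ 2 < r ∧ 0 < (halfDir θ / w).re ∧
      Real.sin (η / 2) / ‖w‖ ^ 2 ≤ ((halfDir θ / w) ^ 2).re := by
  obtain ⟨x, φ, hx, hxR, hφ, rfl⟩ := hw
  have hns := norm_surfacePoint_sq hx φ
  have hsx : 0 < Real.sqrt x := Real.sqrt_pos.2 hx
  have hdiv : halfDir θ / surfacePoint x φ =
      ((Real.sqrt x)⁻¹ : ℝ) * Complex.exp (((θ - φ) / 2 : ℝ) * Complex.I) := by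
    have : ((θ - φ) / 2 : ℝ) * Complex.I =
      Complex.I * (θ / 2 : ℝ) - Complex.I * (φ / 2 : ℝ) := by push_cast; ring
    rw [halfDir, surfacePoint, this, Complex.exp_sub]
    push_cast
    field_simp
  rw [abs_lt] at hφ
  refine ⟨surfacePoint_ne_zero hx φ, by rwa [hns], ?_, ?_⟩
  · rw [hdiv, Complex.re_ofReal_mul, Complex.exp_ofReal_mul_I_re]
    refine mul_pos (inv_pos.2 hsx) (Real.cos_pos_of_mem_Ioo ⟨?_, ?_⟩) <;> linarith
  · rw [hdiv, mul_pow, ← Complex.exp_nat_mul, hns]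
    have : ((2 : ℕ) : ℂ) * (((θ - φ) / 2 : ℝ) * Complex.I) = ((θ - φ : ℝ) : ℂ) * Complex.I := by
      push_cast; ring
    rw [this, ← Complex.ofReal_pow, Complex.re_ofReal_mul, Complex.exp_ofReal_mul_I_re, inv_pow,
      Real.sq_sqrt hx.le, div_eq_inv_mul]
    refine mul_le_mul_of_nonneg_left ?_ (by positivity)
    rw [← Real.cos_abs (θ - φ), ← Real.cos_pi_div_two_sub]
    refine Real.cos_le_cos_of_nonneg_of_le_pi (abs_nonneg _) (by linarith) ?_
    rw [abs_le]; constructor <;> linarith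

/-! ### Gaussian moments -/

theorem integrable_pow_mul_gaussian {c : ℂ} (hc : 0 < c.re) (n : ℕ) :
    Integrable fun x : ℝ => (x : ℂ) ^ n * Complex.exp (-c * x ^ 2) := by
  have h := (integrable_rpow_mul_exp_neg_mul_sq hc (s := (n : ℝ))
    (by have := n.cast_nonneg (α := ℝ); linarith)).norm
  refine h.mono' (by fun_prop) (ae_of_all _ fun x => le_of_eq ?_)
  rw [norm_mul, norm_mul, Complex.norm_exp, Real.rpow_natCast, norm_pow, norm_pow,
    Complex.norm_real, Real.norm_of_nonneg (Real.exp_pos _).le]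
  congr 2
  rw [← Complex.ofReal_pow, Complex.re_mul_ofReal, Complex.neg_re]

/-- Integration by parts. -/
theorem integral_pow_add_two_mul_gaussian {c : ℂ} (hc : 0 < c.re) (n : ℕ) :
    2 * c * ∫ x in Ioi (0 : ℝ), (x : ℂ) ^ (2 * (n + 1)) * Complex.exp (-c * x ^ 2) =
      (2 * n + 1) * ∫ x in Ioi (0 : ℝ), (x : ℂ) ^ (2 * n) * Complex.exp (-c * x ^ 2) := by
  have hI := fun k => (integrable_pow_mul_gaussian hc k).integrableOn (s := Ioi (0 : ℝ))
  have hd : ∀ x : ℝ, HasDerivAt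
      (fun x : ℝ => (x : ℂ) ^ (2 * n + 1) * Complex.exp (-c * x ^ 2))
      ((2 * n + 1) * ((x : ℂ) ^ (2 * n) * Complex.exp (-c * x ^ 2)) -
        2 * c * ((x : ℂ) ^ (2 * (n + 1)) * Complex.exp (-c * x ^ 2))) x := by
    intro x
    have h1 : HasDerivAt (fun y : ℂ => y ^ (2 * n + 1) * Complex.exp (-c * y ^ 2))
        (((2 * n + 1 : ℕ) : ℂ) * (x : ℂ) ^ (2 * n) * Complex.exp (-c * (x : ℂ) ^ 2) +
          (x : ℂ) ^ (2 * n + 1) *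
            (Complex.exp (-c * (x : ℂ) ^ 2) * (-c * ((2 : ℕ) * (x : ℂ) ^ 1)))) (x : ℂ) :=
      (hasDerivAt_pow (2 * n + 1) (x : ℂ)).mul
        (((hasDerivAt_pow 2 (x : ℂ)).const_mul (-c)).cexp)
    convert h1.comp_ofReal using 1
    push_cast
    ring
  have hint : IntegrableOn (fun x : ℝ =>
      (2 * n + 1) * ((x : ℂ) ^ (2 * n) * Complex.exp (-c * x ^ 2)) -
        2 * c * ((x : ℂ) ^ (2 * (n + 1)) * Complex.exp (-c * x ^ 2))) (Ioi 0) :=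
    ((hI _).const_mul _).sub ((hI _).const_mul _)
  have hlim := tendsto_zero_of_hasDerivAt_of_integrableOn_Ioi (fun x _ => hd x) hint (hI _)
  have h := integral_Ioi_of_hasDerivAt_of_tendsto (hd 0).continuousAt.continuousWithinAt
    (fun x _ => hd x) hint hlim
  rw [integral_sub ((hI _).const_mul _) ((hI _).const_mul _), integral_const_mul,
    integral_const_mul] at h
  simp only [Complex.ofReal_zero, ne_eq, Nat.succ_ne_zero, not_false_eq_true, zero_pow, zero_mul,
    sub_zero] at h
  exact (sub_eq_zero.1 h).symm

theorem integral_gaussian_Ioi_sq {p : ℂ} (hp : 0 < p.re) (hp2 : 0 < (p ^ 2).re) :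
    ∫ x in Ioi (0 : ℝ), Complex.exp (-(p ^ 2 / 4) * x ^ 2) = (Real.sqrt Real.pi : ℂ) / p := by
  have hp0 : p ≠ 0 := by rintro rfl; simp at hp
  have h4 : (p ^ 2 / 4).re = (p ^ 2).re / 4 := by
    rw [show (4 : ℂ) = ((4 : ℝ) : ℂ) by norm_num, Complex.div_ofReal_re]
  rw [integral_gaussian_complex_Ioi (by rw [h4]; positivity)]
  set y : ℂ := 2 * (Real.sqrt Real.pi : ℂ) / p with hy
  have hpi : ((Real.sqrt Real.pi : ℝ) : ℂ) ^ 2 = (Real.pi : ℂ) := by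
    rw [← Complex.ofReal_pow, Real.sq_sqrt Real.pi_pos.le]
  have hysq : (Real.pi : ℂ) / (p ^ 2 / 4) = y ^ 2 := by
    rw [hy, div_pow, mul_pow, hpi]; field_simp; norm_num
  have hyre : 0 < y.re := by
    have : y = ((2 * Real.sqrt Real.pi : ℝ) : ℂ) * p⁻¹ := by rw [hy]; push_cast; ring
    rw [this, Complex.re_ofReal_mul, Complex.inv_re]
    have := Real.sqrt_pos.2 Real.pi_pos
    have := Complex.normSq_pos.2 hp0
    positivity
  rw [hysq, one_div, Complex.sq_cpow_two_inv hyre, hy]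
  ring

theorem integral_even_pow_mul_gaussian {p : ℂ} (hp : 0 < p.re) (hp2 : 0 < (p ^ 2).re) (n : ℕ) :
    ∫ x in Ioi (0 : ℝ), (x : ℂ) ^ (2 * n) * Complex.exp (-(p ^ 2 / 4) * x ^ 2) =
      (Real.sqrt Real.pi : ℂ) / p * (((2 * n).factorial : ℂ) / (n.factorial : ℂ) * (p⁻¹ ^ 2) ^ n) := by
  have hp0 : p ≠ 0 := by rintro rfl; simp at hp
  have h4 : (p ^ 2 / 4).re = (p ^ 2).re / 4 := by
    rw [show (4 : ℂ) = ((4 : ℝ) : ℂ) by norm_num, Complex.div_ofReal_re]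
  have hc : 0 < (p ^ 2 / 4).re := by rw [h4]; positivity
  induction n with
  | zero => simpa using integral_gaussian_Ioi_sq hp hp2
  | succ n ih =>
    have h := integral_pow_add_two_mul_gaussian hc n
    rw [ih] at h
    have h2 : 2 * (p ^ 2 / 4) ≠ 0 := by simp [hp0]
    apply mul_left_cancel₀ h2
    rw [h, show 2 * (n + 1) = (2 * n + 1) + 1 by ring, Nat.factorial_succ, Nat.factorial_succ,
      Nat.factorial_succ, pow_succ (p⁻¹ ^ 2) n]
    have := Nat.cast_ne_zero (R := ℂ).2 n.factorial_ne_zero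
    have : (n : ℂ) + 1 ≠ 0 := by exact_mod_cast n.succ_ne_zero
    push_cast
    generalize (p⁻¹ ^ 2) ^ n = y
    rw [inv_pow]
    field_simp
    ring

theorem factorial_two_mul_le (n : ℕ) :
    ((2 * n).factorial : ℝ) ≤ 4 ^ n * (n.factorial : ℝ) ^ 2 := by
  have h1 : (2 * n).factorial = n.centralBinom * n.factorial * n.factorial := by
    have := Nat.choose_mul_factorial_mul_factorial (show n ≤ 2 * n by omega)
    rw [show 2 * n - n = n by omega] at this
    rw [Nat.centralBinom, this]
  have h2 : n.centralBinom ≤ 4 ^ n := by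
    rw [Nat.centralBinom]
    have := Nat.choose_le_two_pow (2 * n) n
    rwa [pow_mul] at this
  rw [h1]
  push_cast
  have : (n.centralBinom : ℝ) ≤ 4 ^ n := by exact_mod_cast h2
  nlinarith [mul_le_mul_of_nonneg_right this (sq_nonneg (n.factorial : ℝ))]

/-! ### The heat equation with entire initial value -/

/-- Cauchy's estimate on the circle of radius `√(n + 1)` bounds the Taylor coefficients of an
entire function of order at most `2`. -/
theorem IsEntireOfOrderTwo.exists_norm_iteratedDeriv_le {f : ℂ → ℂ} (hf : IsEntireOfOrderTwo f) :
    ∃ C B : ℝ, 0 < C ∧ 0 < B ∧ ∀ n : ℕ, ∀ z ∈ Metric.ball (0 : ℂ) 1,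
      ‖iteratedDeriv (2 * n) f z‖ ≤ (2 * n).factorial * (C * (B ^ n / n.factorial)) := by
  obtain ⟨hd, C₁, C₂, hC₁, hC₂, hle⟩ := hf
  refine ⟨C₁ * Real.exp (4 * C₂), Real.exp (2 * C₂), by positivity, by positivity, ?_⟩
  intro n z hz
  have hz1 : ‖z‖ < 1 := by simpa using hz
  have hR : (0 : ℝ) < Real.sqrt (n + 1) := Real.sqrt_pos.2 (by positivity)
  have hR2 : Real.sqrt (n + 1) ^ 2 = n + 1 := Real.sq_sqrt (by positivity)
  have hb := Complex.norm_iteratedDeriv_le_of_forall_mem_sphere_norm_le (f := f) (c := z)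
    (C := C₁ * Real.exp (C₂ * (2 * (n + 1) + 2))) (2 * n) hR hd.diffContOnCl ?_
  · refine hb.trans ?_
    rw [mul_div_assoc]
    refine mul_le_mul_of_nonneg_left ?_ (by positivity)
    rw [pow_mul, hR2, ← Real.exp_nat_mul]
    have h1 : C₁ * Real.exp (C₂ * (2 * (n + 1) + 2)) =
        C₁ * Real.exp (4 * C₂) * Real.exp (n * (2 * C₂)) := by
      rw [mul_assoc, ← Real.exp_add]; congr 2; ring
    rw [h1, mul_div_assoc]
    refine mul_le_mul_of_nonneg_left ?_ (by positivity)
    refine div_le_div_of_nonneg_left (by positivity) (by positivity) ?_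
    have : n.factorial ≤ (n + 1) ^ n := (Nat.factorial_le_pow n).trans
      (Nat.pow_le_pow_left n.le_succ n)
    exact_mod_cast this
  · intro y hy
    refine (hle y).trans ?_
    have hy' : ‖y - z‖ = Real.sqrt (n + 1) := by simpa [dist_eq_norm] using hy
    have h2 : ‖y‖ ≤ Real.sqrt (n + 1) + 1 := by
      have := norm_add_le (y - z) z
      rw [sub_add_cancel] at this
      linarith
    gcongr
    have h3 : ‖y‖ ^ 2 ≤ (Real.sqrt (n + 1) + 1) ^ 2 := by gcongr
    nlinarith [sq_nonneg (Real.sqrt (n + 1) - 1)]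

/-- The even part `(f (z + σ) + f (z - σ)) / 2` of an entire function `f` around `z`, as a function
of `s = σ ^ 2`, given by its Taylor series. -/
def evenPart (f : ℂ → ℂ) (s z : ℂ) : ℂ :=
  ∑' n : ℕ, iteratedDeriv (2 * n) f z / ((2 * n).factorial : ℂ) * s ^ n

/-- The formal solution `∑ f⁽²ⁿ⁾(z) tⁿ / n!` of the heat equation with initial value `f`, summed at
`t = w ^ 2`. -/
def entireSol (f : ℂ → ℂ) (w z : ℂ) : ℂ :=
  ∑' n : ℕ, iteratedDeriv (2 * n) f z / (n.factorial : ℂ) * (w ^ 2) ^ n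

theorem hasSum_evenPart {f : ℂ → ℂ} (hf : Differentiable ℂ f) (s z : ℂ) :
    HasSum (fun n : ℕ => iteratedDeriv (2 * n) f z / ((2 * n).factorial : ℂ) * s ^ n)
      (evenPart f s z) := by
  obtain ⟨σ, rfl⟩ : ∃ σ, s = σ ^ 2 :=
    (IsAlgClosed.exists_pow_nat_eq s two_pos).imp fun _ h => h.symm
  exact (hasSum_even_taylor (R := ‖σ‖ + 1) hf.differentiableOn (by linarith)).summable.hasSum

theorem evenPart_sq {f : ℂ → ℂ} (hf : Differentiable ℂ f) (σ z : ℂ) :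
    evenPart f (σ ^ 2) z = (f (z + σ) + f (z - σ)) / 2 :=
  (hasSum_evenPart hf _ z).unique
    (hasSum_even_taylor (R := ‖σ‖ + 1) hf.differentiableOn (by linarith))

theorem differentiable_iteratedDeriv {f : ℂ → ℂ} (hf : Differentiable ℂ f) (n : ℕ) :
    Differentiable ℂ (iteratedDeriv n f) :=
  (hf.contDiff (n := ⊤)).differentiable_iteratedDeriv n (by exact_mod_cast WithTop.coe_lt_top _)

theorem IsEntireOfOrderTwo.differentiableOn_evenPart {f : ℂ → ℂ} (hf : IsEntireOfOrderTwo f) :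
    DifferentiableOn ℂ (fun p : ℂ × ℂ => evenPart f p.1 p.2) (univ ×ˢ Metric.ball (0 : ℂ) 1) := by
  obtain ⟨C, B, hC, hB, hle⟩ := hf.exists_norm_iteratedDeriv_le
  have key : ∀ R : ℝ, DifferentiableOn ℂ (fun p : ℂ × ℂ => evenPart f p.1 p.2)
      (Metric.ball (0 : ℂ) R ×ˢ Metric.ball (0 : ℂ) 1) := by
    intro R
    refine differentiableOn_tsum_of_norm_le (Metric.isOpen_ball.prod Metric.isOpen_ball)
      (((Real.summable_pow_div_factorial (B * R)).mul_left C)) (fun n => ?_) (fun n p hp => ?_)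
    · have : Differentiable ℂ fun p : ℂ × ℂ => iteratedDeriv (2 * n) f p.2 :=
        (differentiable_iteratedDeriv hf.1 (2 * n)).comp differentiable_snd
      simp only [div_eq_mul_inv]
      exact ((this.mul_const _).mul (differentiable_fst.pow n)).differentiableOn
    · have h1 := hle n p.2 hp.2
      have h2 : ‖p.1‖ ≤ R := by
        have := hp.1
        simp only [Metric.mem_ball, dist_zero_right] at this
        exact this.le
      have hR : 0 ≤ R := (norm_nonneg _).trans h2
      have hfac : (0 : ℝ) < (2 * n).factorial := by positivity
      rw [norm_mul, norm_div, norm_pow, Complex.norm_natCast]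
      calc ‖iteratedDeriv (2 * n) f p.2‖ / ((2 * n).factorial : ℝ) * ‖p.1‖ ^ n
          ≤ (C * (B ^ n / n.factorial)) * R ^ n := by
            gcongr
            rw [div_le_iff₀' hfac]; exact h1
        _ = C * ((B * R) ^ n / n.factorial) := by rw [mul_pow]; ring
  rintro ⟨s, z⟩ ⟨-, hz⟩
  have hmem : (s, z) ∈ Metric.ball (0 : ℂ) (‖s‖ + 1) ×ˢ Metric.ball (0 : ℂ) 1 :=
    ⟨by simp, hz⟩
  exact ((key (‖s‖ + 1)).differentiableAt
    ((Metric.isOpen_ball.prod Metric.isOpen_ball).mem_nhds hmem)).differentiableWithinAt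


/-- The coefficients of order `Bⁿ / n!` of the even Taylor series become geometric after
multiplication by `(2n)! / n! ≤ 4ⁿ n!`. -/
theorem norm_entireSol_term_le {f : ℂ → ℂ} {C B r : ℝ} (hC : 0 < C) (hB : 0 < B)
    (hle : ∀ n : ℕ, ∀ z ∈ Metric.ball (0 : ℂ) 1,
      ‖iteratedDeriv (2 * n) f z‖ ≤ (2 * n).factorial * (C * (B ^ n / n.factorial)))
    {w z : ℂ} (hw : ‖w‖ ^ 2 ≤ r) (hz : z ∈ Metric.ball (0 : ℂ) 1) (n : ℕ) :
    ‖iteratedDeriv (2 * n) f z / (n.factorial : ℂ) * (w ^ 2) ^ n‖ ≤ C * (4 * B * r) ^ n := by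
  have hn : (0 : ℝ) < n.factorial := by positivity
  rw [norm_mul, norm_div, norm_pow, norm_pow, Complex.norm_natCast]
  have h1 : ‖iteratedDeriv (2 * n) f z‖ / n.factorial ≤ C * (4 * B) ^ n := by
    rw [div_le_iff₀ hn]
    refine (hle n z hz).trans ?_
    calc ((2 * n).factorial : ℝ) * (C * (B ^ n / n.factorial))
        ≤ (4 ^ n * (n.factorial : ℝ) ^ 2) * (C * (B ^ n / n.factorial)) := by
          gcongr; exact factorial_two_mul_le n
      _ = C * (4 * B) ^ n * n.factorial := by rw [mul_pow]; field_simp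
  calc _ ≤ (C * (4 * B) ^ n) * r ^ n := by gcongr
    _ = _ := by rw [mul_pow _ r]; ring

/-- The heat equation for `entireSol f`, by termwise differentiation of the series. -/
theorem IsEntireOfOrderTwo.exists_entireSol {f : ℂ → ℂ} (hf : IsEntireOfOrderTwo f) :
    ∃ r : ℝ, 0 < r ∧
      DifferentiableOn ℂ (fun p : ℂ × ℂ => entireSol f p.1 p.2)
        ({w | ‖w‖ ^ 2 < r} ×ˢ Metric.ball (0 : ℂ) 1) ∧
      ∀ w z : ℂ, w ≠ 0 → ‖w‖ ^ 2 < r → z ∈ Metric.ball (0 : ℂ) 1 →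
        (2 * w)⁻¹ * deriv (fun w' => entireSol f w' z) w =
          iteratedDeriv 2 (fun z' => entireSol f w z') z := by
  obtain ⟨C, B, hC, hB, hle⟩ := hf.exists_norm_iteratedDeriv_le
  -- `|t| < 1 / (8B)` bounds the terms by a geometric series of ratio `1/2`
  refine ⟨1 / (8 * B), by positivity, ?_, ?_⟩
  all_goals
    have hsum : Summable fun n : ℕ => C * (4 * B * (1 / (8 * B))) ^ n := by
      refine (summable_geometric_of_lt_one (by positivity) ?_).mul_left C
      field_simp; norm_num
    have hopen : IsOpen {w : ℂ | ‖w‖ ^ 2 < 1 / (8 * B)} :=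
      isOpen_lt (by fun_prop) continuous_const
  · refine differentiableOn_tsum_of_norm_le (hopen.prod Metric.isOpen_ball) hsum
      (fun n => ?_) (fun n p hp => norm_entireSol_term_le hC hB hle (le_of_lt hp.1) hp.2 n)
    have : Differentiable ℂ fun p : ℂ × ℂ => iteratedDeriv (2 * n) f p.2 :=
      (differentiable_iteratedDeriv hf.1 (2 * n)).comp differentiable_snd
    simp only [div_eq_mul_inv]
    exact ((this.mul_const _).mul ((differentiable_fst.pow 2).pow n)).differentiableOn
  · intro w z hw0 hw hz
    have hD := fun n => differentiable_iteratedDeriv hf.1 n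
    -- the derivative in `w`
    have h1 := Complex.hasSum_deriv_of_summable_norm hsum
      (F := fun (n : ℕ) (w : ℂ) => iteratedDeriv (2 * n) f z / (n.factorial : ℂ) * (w ^ 2) ^ n)
      (fun n => by fun_prop) hopen
      (fun n v hv => norm_entireSol_term_le hC hB hle (le_of_lt hv) hz n) hw
    have h1' := h1.mul_left (2 * w)⁻¹
    rw [← hasSum_nat_add_iff' 1] at h1'
    simp only [Finset.range_one, Finset.sum_singleton, pow_zero, mul_one, mul_zero,
      deriv_const, sub_zero] at h1'
    -- the second derivative in `z`
    have h2 : ∀ v ∈ Metric.ball (0 : ℂ) 1, HasSum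
        (fun n : ℕ => iteratedDeriv (2 * n + 1) f v / (n.factorial : ℂ) * (w ^ 2) ^ n)
        (deriv (fun z => entireSol f w z) v) := by
      intro v hv
      have := Complex.hasSum_deriv_of_summable_norm hsum
        (F := fun (n : ℕ) (z : ℂ) => iteratedDeriv (2 * n) f z / (n.factorial : ℂ) * (w ^ 2) ^ n)
        (fun n => (((hD _).div_const _).mul_const _).differentiableOn) Metric.isOpen_ball
        (fun n v hv => norm_entireSol_term_le hC hB hle hw.le hv n) hv
      refine this.congr_fun fun n => ?_
      simp [iteratedDeriv_succ]
    obtain ⟨R, hR, hRz⟩ := Metric.isOpen_iff.1 Metric.isOpen_ball z hz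
    have hball : ∀ x ∈ Metric.ball z (R / 2), Metric.ball x (R / 2) ⊆ Metric.ball (0 : ℂ) 1 := by
      intro x hx y hy
      apply hRz
      have := dist_triangle y x z
      simp only [Metric.mem_ball] at *
      linarith
    have hb : ∀ (n : ℕ), ∀ v ∈ Metric.ball z (R / 2),
        ‖iteratedDeriv (2 * n + 1) f v / (n.factorial : ℂ) * (w ^ 2) ^ n‖ ≤
          C * (4 * B * (1 / (8 * B))) ^ n / (R / 4) := by
      intro n v hv
      have hd : Differentiable ℂ fun z =>
          iteratedDeriv (2 * n) f z / (n.factorial : ℂ) * (w ^ 2) ^ n :=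
        ((hD _).div_const _).mul_const _
      have := Complex.norm_deriv_le_of_forall_mem_sphere_norm_le (c := v) (R := R / 4)
        (by linarith) hd.diffContOnCl (C := C * (4 * B * (1 / (8 * B))) ^ n) (fun y hy =>
          norm_entireSol_term_le hC hB hle hw.le (hball v hv (by
            simp only [mem_sphere_iff_norm] at hy
            simp only [Metric.mem_ball, dist_eq_norm, hy]
            linarith)) n)
      simpa [iteratedDeriv_succ] using this
    have h3 := Complex.hasSum_deriv_of_summable_norm (hsum.div_const (R / 4))
      (F := fun (n : ℕ) (z : ℂ) => iteratedDeriv (2 * n + 1) f z / (n.factorial : ℂ) * (w ^ 2) ^ n)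
      (fun n => (((hD _).div_const _).mul_const _).differentiableOn) Metric.isOpen_ball
      hb (Metric.mem_ball_self (by linarith : (0 : ℝ) < R / 2))
    have h4 : deriv (fun w_1 => ∑' (i : ℕ),
        iteratedDeriv (2 * i + 1) f w_1 / (i.factorial : ℂ) * (w ^ 2) ^ i) z =
        iteratedDeriv 2 (fun z' => entireSol f w z') z := by
      rw [iteratedDeriv_succ, iteratedDeriv_one]
      refine Filter.EventuallyEq.deriv_eq ?_
      filter_upwards [Metric.isOpen_ball.mem_nhds hz] with v hv
      exact (h2 v hv).tsum_eq
    rw [h4] at h3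
    refine h1'.unique (h3.congr_fun fun n => ?_)
    have hfac : (n.factorial : ℂ) ≠ 0 := Nat.cast_ne_zero.2 n.factorial_ne_zero
    have hn1 : (n : ℂ) + 1 ≠ 0 := by exact_mod_cast n.succ_ne_zero
    have hdw : deriv (fun w : ℂ => (w ^ 2) ^ (n + 1)) w = (n + 1) * (w ^ 2) ^ n * (2 * w) := by
      simp
    rw [deriv_const_mul_field, hdw, deriv_mul_const_field, deriv_div_const,
      ← iteratedDeriv_succ, show 2 * (n + 1) = 2 * n + 1 + 1 by ring, Nat.factorial_succ]
    push_cast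
    field_simp

/-- Integrating the Taylor series of `f (z + x e) + f (z - x e)` against a Gaussian term by term
turns `∑ f⁽²ⁿ⁾(z) s²ⁿ / (2n)!` into `∑ f⁽²ⁿ⁾(z) tⁿ / n!`. -/
theorem IsEntireOfOrderTwo.exists_integral_eq_entireSol {f : ℂ → ℂ} (hf : IsEntireOfOrderTwo f) :
    ∃ K : ℝ, 0 < K ∧ ∀ e p z : ℂ, ‖e‖ = 1 → 0 < p.re → K < (p ^ 2).re →
      z ∈ Metric.ball (0 : ℂ) 1 →
      IntegrableOn (fun x : ℝ => (f (z + x * e) + f (z - x * e)) *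
        Complex.exp (-(p ^ 2 / 4) * x ^ 2)) (Ioi 0) ∧
      ∫ x in Ioi (0 : ℝ), (f (z + x * e) + f (z - x * e)) *
        Complex.exp (-(p ^ 2 / 4) * x ^ 2) =
          2 * (Real.sqrt Real.pi : ℂ) / p * entireSol f (e / p) z := by
  obtain ⟨C, B, hC, hB, hle⟩ := hf.exists_norm_iteratedDeriv_le
  refine ⟨4 * B, by positivity, ?_⟩
  intro e p z he hp hpB hz
  have h4 : (p ^ 2 / 4).re = (p ^ 2).re / 4 := by
    rw [show (4 : ℂ) = ((4 : ℝ) : ℂ) by norm_num, Complex.div_ofReal_re]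
  have hc : 0 < (p ^ 2 / 4).re := by rw [h4]; linarith
  set c : ℂ := p ^ 2 / 4 with hcdef
  let F : ℕ → ℝ → ℂ := fun n x =>
    2 * (iteratedDeriv (2 * n) f z / ((2 * n).factorial : ℂ) * (e ^ 2) ^ n) *
      ((x : ℂ) ^ (2 * n) * Complex.exp (-c * x ^ 2))
  let bd : ℕ → ℝ → ℝ := fun n x =>
    2 * C * Real.exp (-c.re * x ^ 2) * ((B * x ^ 2) ^ n / n.factorial)
  have hF : ∀ x : ℝ, HasSum (fun n => F n x)
      ((f (z + x * e) + f (z - x * e)) * Complex.exp (-c * x ^ 2)) := by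
    intro x
    have h := (hasSum_even_taylor (f := f) (z := z) (σ := x * e) (R := ‖(x : ℂ) * e‖ + 1)
      hf.1.differentiableOn (by linarith)).mul_left (2 * Complex.exp (-c * x ^ 2))
    have h' : 2 * Complex.exp (-c * x ^ 2) * ((f (z + x * e) + f (z - x * e)) / 2) =
      (f (z + x * e) + f (z - x * e)) * Complex.exp (-c * x ^ 2) := by ring
    rw [h'] at h
    refine h.congr_fun fun n => ?_
    simp only [F, mul_pow, pow_mul]
    ring
  have hbd : ∀ x : ℝ, HasSum (fun n => bd n x)
      (2 * C * Real.exp (-(c.re - B) * x ^ 2)) := by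
    intro x
    have h := (NormedSpace.expSeries_div_hasSum_exp (B * x ^ 2)).mul_left
      (2 * C * Real.exp (-c.re * x ^ 2))
    rw [← Real.exp_eq_exp_ℝ, mul_assoc (2 * C), ← Real.exp_add] at h
    rwa [show -c.re * x ^ 2 + B * x ^ 2 = -(c.re - B) * x ^ 2 by ring] at h
  have hFbd : ∀ n x, ‖F n x‖ ≤ bd n x := by
    intro n x
    have hfac : (0 : ℝ) < (2 * n).factorial := by positivity
    simp only [F, bd, norm_mul, norm_div, norm_pow, he, one_pow, mul_one, Complex.norm_natCast,
      Complex.norm_ofNat, Complex.norm_real, Complex.norm_exp, Real.norm_eq_abs]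
    have h1 : ‖iteratedDeriv (2 * n) f z‖ / ((2 * n).factorial : ℝ) ≤ C * (B ^ n / n.factorial) := by
      rw [div_le_iff₀' hfac]; exact hle n z hz
    have h2 : (-c * (x : ℂ) ^ 2).re = -c.re * x ^ 2 := by
      rw [← Complex.ofReal_pow, Complex.re_mul_ofReal, Complex.neg_re]
    have h3 : |x| ^ (2 * n) = (x ^ 2) ^ n := by rw [pow_mul, sq_abs]
    rw [h2, h3]
    calc _ ≤ 2 * (C * (B ^ n / n.factorial)) * ((x ^ 2) ^ n * Real.exp (-c.re * x ^ 2)) := by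
          gcongr
      _ = _ := by rw [mul_pow]; ring
  have hint : Integrable (fun x : ℝ => 2 * C * Real.exp (-(c.re - B) * x ^ 2)) := by
    refine (integrable_exp_neg_mul_sq ?_).const_mul _
    rw [h4]; linarith
  have hcont : Continuous fun x : ℝ =>
      (f (z + x * e) + f (z - x * e)) * Complex.exp (-c * x ^ 2) := by
    have := hf.1.continuous
    fun_prop
  refine ⟨(hint.mono' hcont.aestronglyMeasurable (ae_of_all _ fun x => ?_)).integrableOn, ?_⟩
  · rw [← (hF x).tsum_eq]
    exact tsum_of_norm_bounded (hbd x) (hFbd · x)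
  · have hsum := hasSum_integral_of_dominated_convergence (μ := volume.restrict (Ioi (0 : ℝ)))
      bd (F := F) (fun n => by fun_prop) (fun n => ae_of_all _ fun x => hFbd n x)
      (ae_of_all _ fun x => (hbd x).summable)
      (by simp_rw [(hbd _).tsum_eq]; exact hint.integrableOn) (ae_of_all _ hF)
    have hp0 : p ≠ 0 := by rintro rfl; simp at hp
    rw [← hsum.tsum_eq, entireSol, ← tsum_mul_left]
    congr 1
    ext n
    simp only [F]
    rw [integral_const_mul, hcdef, integral_even_pow_mul_gaussian hp (by linarith)]
    have hfac : (n.factorial : ℂ) ≠ 0 := Nat.cast_ne_zero.2 n.factorial_ne_zero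
    have hfac2 : ((2 * n).factorial : ℂ) ≠ 0 := Nat.cast_ne_zero.2 (2 * n).factorial_ne_zero
    rw [div_pow, div_eq_mul_inv (e ^ 2), mul_pow, inv_pow]
    generalize ((p ^ 2)⁻¹) ^ n = y
    field_simp

/-! ### The contribution of the pole -/

theorem exists_primitive_exp_sq_div_four :
    ∃ M : ℂ → ℂ, (∀ q, HasDerivAt M (Complex.exp (q ^ 2 / 4)) q) ∧ M 0 = 0 := by
  have hd : Differentiable ℂ fun q : ℂ => Complex.exp (q ^ 2 / 4) := by fun_prop
  obtain ⟨M, hM⟩ := hd.isExactOn_univ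
  exact ⟨fun q => M q - M 0, fun q => (hM q (mem_univ q)).sub_const _, sub_self _⟩

/-- The entire function `∫₀^q exp (p² / 4) dp`, a variant of the error function. -/
def expSqPrimitive : ℂ → ℂ := exists_primitive_exp_sq_div_four.choose

theorem hasDerivAt_expSqPrimitive (q : ℂ) :
    HasDerivAt expSqPrimitive (Complex.exp (q ^ 2 / 4)) q :=
  exists_primitive_exp_sq_div_four.choose_spec.1 q

theorem expSqPrimitive_zero : expSqPrimitive 0 = 0 :=
  exists_primitive_exp_sq_div_four.choose_spec.2

/-- The entire continuation of the Cauchy integral `∫₀^∞ 2q / (v² - q²) exp (-v² / 4) dv` from the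
upper (`σ = 1`) or the lower (`σ = -1`) half plane of `q`. -/
def poleKernel (σ : ℝ) (q : ℂ) : ℂ :=
  Complex.exp (-q ^ 2 / 4) *
    (σ * (Complex.I * Real.pi) - (Real.sqrt Real.pi : ℂ) * expSqPrimitive q)

theorem hasDerivAt_poleKernel (σ : ℝ) (q : ℂ) :
    HasDerivAt (poleKernel σ) (-(q / 2) * poleKernel σ q - (Real.sqrt Real.pi : ℂ)) q := by
  have h1 : HasDerivAt (fun q : ℂ => Complex.exp (-q ^ 2 / 4))
      (Complex.exp (-q ^ 2 / 4) * (-((2 : ℕ) * q ^ 1) / 4)) q :=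
    ((hasDerivAt_pow 2 q).neg.div_const 4).cexp
  have h2 : HasDerivAt (fun q : ℂ => σ * (Complex.I * Real.pi) -
      (Real.sqrt Real.pi : ℂ) * expSqPrimitive q)
      (-((Real.sqrt Real.pi : ℂ) * Complex.exp (q ^ 2 / 4))) q :=
    ((hasDerivAt_expSqPrimitive q).const_mul _).const_sub _
  have h3 : Complex.exp (-q ^ 2 / 4) * Complex.exp (q ^ 2 / 4) = 1 := by
    rw [← Complex.exp_add]; simp [neg_div]
  refine (h1.mul h2).congr_deriv ?_
  rw [poleKernel]
  linear_combination (-(Real.sqrt Real.pi : ℂ)) * h3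

/-- The part of the solution of the heat equation due to the pole `a / (z - z₀)` of the initial
value, in the coordinate `w = √t`. -/
def poleSol (σ : ℝ) (a z₀ w z : ℂ) : ℂ :=
  a / (2 * (Real.sqrt Real.pi : ℂ) * w) * poleKernel σ ((z₀ - z) / w)

theorem differentiableOn_poleSol (σ : ℝ) (a z₀ : ℂ) :
    DifferentiableOn ℂ (fun p : ℂ × ℂ => poleSol σ a z₀ p.1 p.2) ({0}ᶜ ×ˢ univ) := by
  rintro ⟨w, z⟩ ⟨hw, -⟩
  have hw : w ≠ 0 := hw
  have hpi : (Real.sqrt Real.pi : ℂ) ≠ 0 := by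
    exact_mod_cast (Real.sqrt_pos.2 Real.pi_pos).ne'
  have hK : Differentiable ℂ (poleKernel σ) := fun q => (hasDerivAt_poleKernel σ q).differentiableAt
  have h1 : DifferentiableAt ℂ (fun p : ℂ × ℂ => (z₀ - p.2) / p.1) (w, z) := by
    fun_prop (disch := assumption)
  have h2 : DifferentiableAt ℂ (fun p : ℂ × ℂ => a / (2 * (Real.sqrt Real.pi : ℂ) * p.1))
      (w, z) := by
    have : 2 * (Real.sqrt Real.pi : ℂ) * w ≠ 0 :=
      mul_ne_zero (mul_ne_zero two_ne_zero hpi) hw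
    fun_prop (disch := assumption)
  exact (h2.mul ((hK _).comp (w, z) h1)).differentiableWithinAt

theorem poleSol_heat (σ : ℝ) (a z₀ : ℂ) {w : ℂ} (hw : w ≠ 0) (z : ℂ) :
    (2 * w)⁻¹ * deriv (fun w' => poleSol σ a z₀ w' z) w =
      iteratedDeriv 2 (fun z' => poleSol σ a z₀ w z') z := by
  have hpi : (Real.sqrt Real.pi : ℂ) ≠ 0 := by
    exact_mod_cast (Real.sqrt_pos.2 Real.pi_pos).ne'
  have hz : ∀ z, HasDerivAt (fun z' => (z₀ - z') / w) (-1 / w) z := fun z =>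
    ((hasDerivAt_id z).const_sub z₀).div_const w
  have hKz : ∀ z, HasDerivAt (fun z' => poleKernel σ ((z₀ - z') / w))
      ((-((z₀ - z) / w / 2) * poleKernel σ ((z₀ - z) / w) - (Real.sqrt Real.pi : ℂ)) * (-1 / w))
      z := by
    intro z
    have := (hasDerivAt_poleKernel σ ((z₀ - z) / w)).comp z (hz z)
    exact this
  have h1 : deriv (fun z' => poleSol σ a z₀ w z') = fun z' =>
      a / (2 * (Real.sqrt Real.pi : ℂ) * w) * ((-((z₀ - z') / w / 2) *
        poleKernel σ ((z₀ - z') / w) - (Real.sqrt Real.pi : ℂ)) * (-1 / w)) := by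
    ext z'
    exact ((hKz z').const_mul _).deriv
  have h2 := ((((((hz z).div_const 2).neg).mul (hKz z)).sub_const
    (Real.sqrt Real.pi : ℂ)).mul_const (-1 / w)).const_mul (a / (2 * (Real.sqrt Real.pi : ℂ) * w))
  have hw1 : HasDerivAt (fun w' => (z₀ - z) / w') (-(z₀ - z) / w ^ 2) w := by
    have := (hasDerivAt_inv hw).const_mul (z₀ - z)
    simp only [← div_eq_mul_inv] at this
    exact this.congr_deriv (by ring)
  have hw2 : HasDerivAt (fun w' => a / (2 * (Real.sqrt Real.pi : ℂ) * w'))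
      (-(a / (2 * (Real.sqrt Real.pi : ℂ) * w ^ 2))) w := by
    have := (hasDerivAt_inv hw).const_mul (a / (2 * (Real.sqrt Real.pi : ℂ)))
    refine (this.congr_of_eventuallyEq (Eventually.of_forall fun v => ?_)).congr_deriv ?_
    · simp only [div_mul_eq_div_div]; ring
    · field_simp
  have h3 := hw2.mul ((hasDerivAt_poleKernel σ ((z₀ - z) / w)).comp w hw1)
  have e2 := h2.deriv
  have e3 := h3.deriv
  change deriv (fun w' => poleSol σ a z₀ w' z) w = _ at e3
  rw [iteratedDeriv_succ, iteratedDeriv_one, h1, e3]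
  refine Eq.trans ?_ e2.symm
  simp only [Function.comp, Pi.neg_apply]
  generalize poleKernel σ ((z₀ - z) / w) = k
  field_simp
  ring

/-! ### The Cauchy integral of a Gaussian along a ray -/

/-- Both factors of `x² - κ²` have imaginary part `± im κ`. -/
theorem sq_im_le_norm_sq_sub_sq (κ : ℂ) (x : ℝ) : κ.im ^ 2 ≤ ‖(x : ℂ) ^ 2 - κ ^ 2‖ := by
  have h1 : |κ.im| ≤ ‖(x : ℂ) - κ‖ := by simpa using Complex.abs_im_le_norm ((x : ℂ) - κ)
  have h2 : |κ.im| ≤ ‖(x : ℂ) + κ‖ := by simpa using Complex.abs_im_le_norm ((x : ℂ) + κ)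
  rw [sq_sub_sq, norm_mul, ← sq_abs, sq, mul_comm]
  gcongr

theorem sq_sub_sq_ne_zero_of_im {κ : ℂ} (hκ : κ.im ≠ 0) (x : ℝ) : (x : ℂ) ^ 2 - κ ^ 2 ≠ 0 := by
  intro h
  have := sq_im_le_norm_sq_sub_sq κ x
  rw [h, norm_zero] at this
  have := sq_pos_of_ne_zero hκ
  linarith

/-- The kernel `1 / (x² - κ²)` is bounded on the real line by a multiple of `1 / (1 + x²)`. -/
theorem exists_norm_inv_sq_sub_sq_le {κ : ℂ} (hκ : κ.im ≠ 0) :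
    ∃ A : ℝ, 0 < A ∧ ∀ x : ℝ, ‖((x : ℂ) ^ 2 - κ ^ 2)⁻¹‖ ≤ A * (1 + x ^ 2)⁻¹ := by
  have him := sq_pos_of_ne_zero hκ
  refine ⟨1 + (‖κ‖ ^ 2 + 1) / κ.im ^ 2, by positivity, fun x => ?_⟩
  have h0 := sq_im_le_norm_sq_sub_sq κ x
  have h1 : 0 < ‖(x : ℂ) ^ 2 - κ ^ 2‖ := him.trans_le h0
  rw [norm_inv, inv_le_comm₀ h1 (by positivity), mul_inv, inv_inv, ← div_eq_inv_mul,
    div_le_iff₀ (by positivity)]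
  have h2 : x ^ 2 ≤ ‖(x : ℂ) ^ 2 - κ ^ 2‖ + ‖κ‖ ^ 2 := by
    have := norm_sub_norm_le ((x : ℂ) ^ 2) (κ ^ 2)
    rw [norm_pow, norm_pow, Complex.norm_real, Real.norm_eq_abs, sq_abs] at this
    linarith
  have h3 : ‖κ‖ ^ 2 + 1 ≤ ‖(x : ℂ) ^ 2 - κ ^ 2‖ * ((‖κ‖ ^ 2 + 1) / κ.im ^ 2) := by
    rw [mul_div_assoc', le_div_iff₀ him, mul_comm]
    gcongr
  linarith

theorem continuous_inv_sq_sub_sq {κ : ℂ} (hκ : κ.im ≠ 0) :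
    Continuous fun x : ℝ => ((x : ℂ) ^ 2 - κ ^ 2)⁻¹ :=
  Continuous.inv₀ (by fun_prop) (sq_sub_sq_ne_zero_of_im hκ)

/-- The value of the Cauchy integral without the Gaussian factor: half a residue. -/
theorem integral_two_mul_div_sq_sub_sq {σ : ℝ} (hσ : σ = 1 ∨ σ = -1) {κ : ℂ}
    (hκ : 0 < σ * κ.im) :
    ∫ x in Ioi (0 : ℝ), 2 * κ * ((x : ℂ) ^ 2 - κ ^ 2)⁻¹ = σ * (Complex.I * Real.pi) := by
  have him : κ.im ≠ 0 := by rintro h; simp [h] at hκ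
  have hκ0 : κ ≠ 0 := by rintro rfl; simp at him
  have hint : IntegrableOn (fun x : ℝ => 2 * κ * ((x : ℂ) ^ 2 - κ ^ 2)⁻¹) (Ioi 0) := by
    obtain ⟨A, -, hA⟩ := exists_norm_inv_sq_sub_sq_le him
    refine Integrable.const_mul ?_ _
    exact ((integrable_inv_one_add_sq.const_mul A).mono'
      (continuous_inv_sq_sub_sq him).aestronglyMeasurable (ae_of_all _ hA)).integrableOn
  have hd : ∀ x : ℝ, HasDerivAt (fun x : ℝ => Complex.log (x - κ) - Complex.log (x + κ))
      (2 * κ * ((x : ℂ) ^ 2 - κ ^ 2)⁻¹) x := by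
    intro x
    have hm : (x : ℂ) - κ ∈ Complex.slitPlane := Or.inr (by simpa using him)
    have hp : (x : ℂ) + κ ∈ Complex.slitPlane := Or.inr (by simpa using him)
    have h := (((hasDerivAt_id (x : ℂ)).sub_const κ).clog hm).sub
      (((hasDerivAt_id (x : ℂ)).add_const κ).clog hp)
    refine h.comp_ofReal.congr_deriv ?_
    have h1 := Complex.slitPlane_ne_zero hm
    have h2 := Complex.slitPlane_ne_zero hp
    rw [sq_sub_sq]
    simp only [id]
    field_simp
    ring
  have hlim : Tendsto (fun x : ℝ => Complex.log (x - κ) - Complex.log (x + κ)) atTop (𝓝 0) := by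
    have h0 : Tendsto (fun x : ℝ => κ / (x : ℂ)) atTop (𝓝 0) := by
      have : Tendsto (fun x : ℝ => ((x⁻¹ : ℝ) : ℂ)) atTop (𝓝 ((0 : ℝ) : ℂ)) :=
        (Complex.continuous_ofReal.tendsto 0).comp tendsto_inv_atTop_zero
      have := this.const_mul κ
      simpa [div_eq_mul_inv] using this
    have h1 : Tendsto (fun x : ℝ => Complex.log (1 - κ / x) - Complex.log (1 + κ / x)) atTop
        (𝓝 (Complex.log (1 - 0) - Complex.log (1 + 0))) := by
      refine Tendsto.sub ?_ ?_
      · exact (h0.const_sub 1).clog (by simp)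
      · exact (h0.const_add 1).clog (by simp)
    simp only [sub_zero, add_zero, Complex.log_one] at h1
    refine h1.congr' ?_
    filter_upwards [eventually_gt_atTop 0] with x hx
    have hx0 : (x : ℂ) ≠ 0 := by exact_mod_cast hx.ne'
    have hm : 1 - κ / x ≠ 0 := by
      intro h
      apply him
      rw [sub_eq_zero, eq_div_iff hx0, one_mul] at h
      rw [← h]; simp
    have hp : 1 + κ / x ≠ 0 := by
      intro h
      apply him
      have h : κ = -x := by field_simp at h; linear_combination h
      rw [h]; simp
    have e1 : (x : ℂ) - κ = x * (1 - κ / x) := by field_simp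
    have e2 : (x : ℂ) + κ = x * (1 + κ / x) := by field_simp
    rw [e1, e2, Complex.log_ofReal_mul hx hm, Complex.log_ofReal_mul hx hp]
    ring
  rw [integral_Ioi_of_hasDerivAt_of_tendsto (hd 0).continuousAt.continuousWithinAt
    (fun x _ => hd x) hint hlim]
  simp only [Complex.ofReal_zero, zero_sub, zero_add, Complex.log, norm_neg]
  rcases hσ with rfl | rfl
  · rw [Complex.arg_neg_eq_arg_sub_pi_of_im_pos (by linarith)]
    push_cast; ring
  · rw [Complex.arg_neg_eq_arg_add_pi_of_im_neg (by linarith)]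
    push_cast; ring

theorem norm_cexp_neg_mul_sq (c : ℂ) (x : ℝ) :
    ‖Complex.exp (-c * x ^ 2)‖ = Real.exp (-c.re * x ^ 2) := by
  rw [Complex.norm_exp, ← Complex.ofReal_pow, Complex.re_mul_ofReal, Complex.neg_re]

theorem integrable_pole_gaussian {κ : ℂ} (hκ : κ.im ≠ 0) {c : ℂ} (hc : 0 < c.re) :
    Integrable fun x : ℝ =>
      2 * κ * ((x : ℂ) ^ 2 - κ ^ 2)⁻¹ * Complex.exp (-c * x ^ 2) := by
  obtain ⟨A, hA0, hA⟩ := exists_norm_inv_sq_sub_sq_le hκ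
  have hcont := continuous_inv_sq_sub_sq hκ
  refine ((integrable_exp_neg_mul_sq hc).const_mul (2 * ‖κ‖ * A)).mono'
    (by fun_prop) (ae_of_all _ fun x => ?_)
  rw [norm_mul, norm_mul, norm_mul, Complex.norm_ofNat, norm_cexp_neg_mul_sq]
  gcongr
  refine (hA x).trans ?_
  have : (1 + x ^ 2)⁻¹ ≤ 1 := inv_le_one_of_one_le₀ (by nlinarith [sq_nonneg x])
  nlinarith

/-- The differential equation in the parameter `c` satisfied by the Cauchy integral of a
Gaussian. -/
theorem hasDerivAt_integral_pole_gaussian {κ : ℂ} (hκ : κ.im ≠ 0) {c : ℂ} (hc : 0 < c.re) :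
    HasDerivAt (fun c : ℂ => ∫ x in Ioi (0 : ℝ),
        2 * κ * ((x : ℂ) ^ 2 - κ ^ 2)⁻¹ * Complex.exp (-c * x ^ 2))
      (-2 * κ * (∫ x in Ioi (0 : ℝ), Complex.exp (-c * x ^ 2)) -
        κ ^ 2 * ∫ x in Ioi (0 : ℝ),
          2 * κ * ((x : ℂ) ^ 2 - κ ^ 2)⁻¹ * Complex.exp (-c * x ^ 2)) c := by
  obtain ⟨A, hA0, hA⟩ := exists_norm_inv_sq_sub_sq_le hκ
  have hcont := continuous_inv_sq_sub_sq hκ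
  have h := hasDerivAt_integral_of_dominated_loc_of_deriv_le
    (μ := volume.restrict (Ioi (0 : ℝ))) (x₀ := c) (s := Metric.ball c (c.re / 2))
    (F := fun c x => 2 * κ * ((x : ℂ) ^ 2 - κ ^ 2)⁻¹ * Complex.exp (-c * x ^ 2))
    (F' := fun c x => 2 * κ * ((x : ℂ) ^ 2 - κ ^ 2)⁻¹ *
      (Complex.exp (-c * x ^ 2) * (-1 * x ^ 2)))
    (bound := fun x => 2 * ‖κ‖ * A * Real.exp (-(c.re / 2) * x ^ 2))
    (Metric.ball_mem_nhds c (by linarith))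
    (Eventually.of_forall fun c => by fun_prop)
    (integrable_pole_gaussian hκ hc).integrableOn
    (by fun_prop)
    (ae_of_all _ fun x c' hc' => ?_)
    ((integrable_exp_neg_mul_sq (by linarith)).const_mul _).integrableOn
    (ae_of_all _ fun x c' _ => ?_)
  · refine h.2.congr_deriv ?_
    have hI1 : IntegrableOn (fun x : ℝ => Complex.exp (-c * x ^ 2)) (Ioi 0) := by
      simpa using (integrable_pow_mul_gaussian hc 0).integrableOn
    rw [← integral_const_mul, ← integral_const_mul, ← integral_sub (hI1.const_mul _)
      ((integrable_pole_gaussian hκ hc).integrableOn.const_mul _)]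
    congr 1
    ext x
    have := sq_sub_sq_ne_zero_of_im hκ x
    field_simp
    ring
  · have hre : c.re / 2 ≤ c'.re := by
      have h1 : ‖c' - c‖ < c.re / 2 := by simpa [dist_eq_norm] using hc'
      have h2 := (abs_le.1 (Complex.abs_re_le_norm (c' - c))).1
      rw [Complex.sub_re] at h2
      linarith
    have hx : ‖(-1 : ℂ) * (x : ℂ) ^ 2‖ = x ^ 2 := by
      rw [norm_mul, norm_neg, norm_one, one_mul, norm_pow, Complex.norm_real, Real.norm_eq_abs,
        sq_abs]
    rw [norm_mul, norm_mul, norm_mul, norm_mul, Complex.norm_ofNat, norm_cexp_neg_mul_sq, hx]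
    have h1 : (1 + x ^ 2)⁻¹ * x ^ 2 ≤ 1 := by
      rw [← div_eq_inv_mul, div_le_one (by positivity)]; linarith
    calc 2 * ‖κ‖ * ‖((x : ℂ) ^ 2 - κ ^ 2)⁻¹‖ * (Real.exp (-c'.re * x ^ 2) * x ^ 2)
        ≤ 2 * ‖κ‖ * (A * (1 + x ^ 2)⁻¹) * (Real.exp (-(c.re / 2) * x ^ 2) * x ^ 2) := by
          gcongr; exact hA x
      _ = 2 * ‖κ‖ * A * Real.exp (-(c.re / 2) * x ^ 2) * ((1 + x ^ 2)⁻¹ * x ^ 2) := by ring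
      _ ≤ _ := mul_le_of_le_one_right (by positivity) h1
  · exact ((((hasDerivAt_id c').neg.mul_const _).cexp).const_mul _)


theorem re_sq_div_four (p : ℂ) : (p ^ 2 / 4).re = (p ^ 2).re / 4 := by
  rw [show (4 : ℂ) = ((4 : ℝ) : ℂ) by norm_num, Complex.div_ofReal_re]

/-- Along `c = λ² p² / 4`, `λ > 0`, the differential equation makes
`exp (κ² c) Φ(c) + √π ∫₀^{λ κ p} exp (q² / 4) dq` constant, where `Φ(c)` is the Cauchy integral;
its value is found by letting `λ` tend to `0`. -/
theorem integral_pole_gaussian {σ : ℝ} (hσ : σ = 1 ∨ σ = -1) {κ : ℂ}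
    (hκ : 0 < σ * κ.im) {p : ℂ} (hp : 0 < p.re) (hp2 : 0 < (p ^ 2).re) :
    ∫ x in Ioi (0 : ℝ), 2 * κ * ((x : ℂ) ^ 2 - κ ^ 2)⁻¹ * Complex.exp (-(p ^ 2 / 4) * x ^ 2) =
      poleKernel σ (κ * p) := by
  have him : κ.im ≠ 0 := by rintro h; simp [h] at hκ
  have hp0 : p ≠ 0 := by rintro rfl; simp at hp
  set Φ : ℂ → ℂ := fun c => ∫ x in Ioi (0 : ℝ),
    2 * κ * ((x : ℂ) ^ 2 - κ ^ 2)⁻¹ * Complex.exp (-c * x ^ 2) with hΦ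
  let G : ℂ → ℂ := fun l => Complex.exp (κ ^ 2 * ((l * p) ^ 2 / 4)) * Φ ((l * p) ^ 2 / 4) +
    (Real.sqrt Real.pi : ℂ) * expSqPrimitive (κ * (l * p))
  have hre : ∀ l : ℝ, 0 < l → 0 < ((l : ℂ) * p).re ∧ 0 < (((l : ℂ) * p) ^ 2).re := by
    intro l hl
    rw [mul_pow, ← Complex.ofReal_pow, Complex.re_ofReal_mul, Complex.re_ofReal_mul]
    constructor <;> positivity
  have hre4 : ∀ l : ℝ, 0 < l → 0 < (((l : ℂ) * p) ^ 2 / 4).re := by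
    intro l hl
    rw [re_sq_div_four]
    have := (hre l hl).2
    positivity
  have hG : ∀ l : ℝ, 0 < l → HasDerivAt (fun l : ℝ => G l) 0 l := by
    intro l hl
    have hl0 : (l : ℂ) ≠ 0 := by exact_mod_cast hl.ne'
    have hlin : HasDerivAt (fun l : ℂ => l * p) p (l : ℂ) := by
      simpa using (hasDerivAt_id (l : ℂ)).mul_const p
    have hsq : HasDerivAt (fun l : ℂ => (l * p) ^ 2 / 4) (l * p ^ 2 / 2) (l : ℂ) := by
      refine ((hlin.pow 2).div_const 4).congr_deriv ?_
      push_cast; ring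
    have h1 := ((hsq.const_mul (κ ^ 2)).cexp).mul
      ((hasDerivAt_integral_pole_gaussian him (hre4 l hl)).comp (l : ℂ) hsq)
    have h2 := ((hasDerivAt_expSqPrimitive (κ * (l * p))).comp (l : ℂ)
      (hlin.const_mul κ)).const_mul (Real.sqrt Real.pi : ℂ)
    have h3 := (h1.add h2).comp_ofReal
    refine h3.congr_deriv ?_
    rw [integral_gaussian_Ioi_sq (hre l hl).1 (hre l hl).2]
    simp only [Function.comp]
    have he : Complex.exp ((κ * (l * p)) ^ 2 / 4) = Complex.exp (κ ^ 2 * ((l * p) ^ 2 / 4)) := by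
      congr 1; ring
    rw [he]
    change _ * Φ _ + _ * ((_ - κ ^ 2 * Φ _) * _) + _ = _
    field_simp
    ring
  have hconst : ∀ l : ℝ, 0 < l → G l = G (1 : ℝ) := fun l hl =>
    isOpen_Ioi.is_const_of_deriv_eq_zero (f := fun l : ℝ => G l) isPreconnected_Ioi
      (fun x hx => (hG x hx).differentiableAt.differentiableWithinAt)
      (fun x hx => (hG x hx).deriv) (mem_Ioi.2 hl) (mem_Ioi.2 one_pos)
  have hcont := continuous_inv_sq_sub_sq him
  have hΦ0 : Tendsto (fun l : ℝ => Φ ((l * p) ^ 2 / 4)) (𝓝[>] 0)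
      (𝓝 (σ * (Complex.I * Real.pi))) := by
    rw [← integral_two_mul_div_sq_sub_sq hσ hκ]
    obtain ⟨A, hA0, hA⟩ := exists_norm_inv_sq_sub_sq_le him
    refine tendsto_integral_filter_of_dominated_convergence
      (fun x => 2 * ‖κ‖ * (A * (1 + x ^ 2)⁻¹)) (Eventually.of_forall fun l => by fun_prop) ?_
      ((integrable_inv_one_add_sq.const_mul A).const_mul _).integrableOn
      (ae_of_all _ fun x => ?_)
    · filter_upwards [self_mem_nhdsWithin] with l hl
      refine ae_of_all _ fun x => ?_
      rw [norm_mul, norm_mul, norm_mul, Complex.norm_ofNat, norm_cexp_neg_mul_sq]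
      have h1 : Real.exp (-(((l : ℂ) * p) ^ 2 / 4).re * x ^ 2) ≤ 1 := by
        rw [Real.exp_le_one_iff]
        have := hre4 l hl
        nlinarith [sq_nonneg x]
      calc _ ≤ 2 * ‖κ‖ * ‖((x : ℂ) ^ 2 - κ ^ 2)⁻¹‖ * 1 := by gcongr
        _ ≤ _ := by rw [mul_one]; gcongr; exact hA x
    · have : Tendsto (fun l : ℝ => 2 * κ * ((x : ℂ) ^ 2 - κ ^ 2)⁻¹ *
          Complex.exp (-(((l : ℂ) * p) ^ 2 / 4) * x ^ 2)) (𝓝 0)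
          (𝓝 (2 * κ * ((x : ℂ) ^ 2 - κ ^ 2)⁻¹ *
          Complex.exp (-((((0 : ℝ) : ℂ) * p) ^ 2 / 4) * x ^ 2))) :=
        Continuous.tendsto (by fun_prop) 0
      simp only [Complex.ofReal_zero, zero_mul, ne_eq, OfNat.ofNat_ne_zero, not_false_eq_true,
        zero_pow, zero_div, neg_zero, Complex.exp_zero, mul_one] at this
      exact this.mono_left nhdsWithin_le_nhds
  have hE : Continuous expSqPrimitive :=
    continuous_iff_continuousAt.2 fun q => (hasDerivAt_expSqPrimitive q).continuousAt
  have hG0 : Tendsto (fun l : ℝ => G l) (𝓝[>] 0) (𝓝 (σ * (Complex.I * Real.pi))) := by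
    have e1 : Tendsto (fun l : ℝ => Complex.exp (κ ^ 2 * (((l : ℂ) * p) ^ 2 / 4))) (𝓝[>] 0)
        (𝓝 (Complex.exp (κ ^ 2 * ((((0 : ℝ) : ℂ) * p) ^ 2 / 4)))) :=
      (Continuous.tendsto (by fun_prop) 0).mono_left nhdsWithin_le_nhds
    have e2 : Tendsto (fun l : ℝ => (Real.sqrt Real.pi : ℂ) * expSqPrimitive (κ * (l * p)))
        (𝓝[>] 0) (𝓝 ((Real.sqrt Real.pi : ℂ) * expSqPrimitive (κ * (((0 : ℝ) : ℂ) * p)))) :=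
      (Continuous.tendsto (by fun_prop) 0).mono_left nhdsWithin_le_nhds
    have := (e1.mul hΦ0).add e2
    simpa [expSqPrimitive_zero] using this
  have hG1 : G (1 : ℝ) = σ * (Complex.I * Real.pi) := by
    refine tendsto_nhds_unique (Tendsto.congr' ?_ tendsto_const_nhds) hG0
    filter_upwards [self_mem_nhdsWithin] with l hl
    exact (hconst l hl).symm
  simp only [G, Complex.ofReal_one, one_mul] at hG1
  change Φ (p ^ 2 / 4) = _
  rw [poleKernel, ← hG1, add_sub_cancel_right, ← mul_assoc, ← Complex.exp_add]
  rw [show -(κ * p) ^ 2 / 4 + κ ^ 2 * (p ^ 2 / 4) = 0 by ring, Complex.exp_zero, one_mul]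

/-- First term of the asymptotic expansion of the Cauchy integral, from
`1 / (x² - κ²) + 1 / κ² = x² / (κ² (x² - κ²))`. -/
theorem exists_norm_poleKernel_add_le {σ : ℝ} (hσ : σ = 1 ∨ σ = -1) {κ : ℂ}
    (hκ : 0 < σ * κ.im) : ∃ A : ℝ, 0 < A ∧ ∀ p : ℂ, 0 < p.re → 0 < (p ^ 2).re →
      ‖poleKernel σ (κ * p) + 2 * (Real.sqrt Real.pi : ℂ) / (κ * p)‖ ≤ A / (p ^ 2).re := by
  have him : κ.im ≠ 0 := by rintro h; simp [h] at hκ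
  have hκ0 : κ ≠ 0 := by rintro rfl; simp at him
  obtain ⟨A, hA0, hA⟩ := exists_norm_inv_sq_sub_sq_le him
  refine ⟨4 * A / ‖κ‖, by positivity, fun p hp hp2 => ?_⟩
  have hc : 0 < (p ^ 2 / 4).re := by rw [re_sq_div_four]; positivity
  have hI1 : IntegrableOn (fun x : ℝ => Complex.exp (-(p ^ 2 / 4) * x ^ 2)) (Ioi 0) := by
    simpa using (integrable_pow_mul_gaussian hc 0).integrableOn
  have hp0 : p ≠ 0 := by rintro rfl; simp at hp
  have h1 : 2 * (Real.sqrt Real.pi : ℂ) / (κ * p) =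
      2 / κ * ∫ x in Ioi (0 : ℝ), Complex.exp (-(p ^ 2 / 4) * x ^ 2) := by
    rw [integral_gaussian_Ioi_sq hp hp2]
    field_simp
  rw [h1, ← integral_pole_gaussian hσ hκ hp hp2, ← integral_const_mul,
    ← integral_add (integrable_pole_gaussian him hc).integrableOn (hI1.const_mul _)]
  set b : ℝ := (p ^ 2 / 4).re with hb
  have hG : ∫ x in Ioi (0 : ℝ), 2 * A / ‖κ‖ * (x * Real.exp (-b * x ^ 2)) =
      2 * A / ‖κ‖ * (2 * b)⁻¹ := by
    rw [integral_const_mul]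
    congr 1
    have := integral_mul_cexp_neg_mul_sq (b := (b : ℂ)) (by simpa using hc)
    have h2 : (((∫ x in Ioi (0 : ℝ), x * Real.exp (-b * x ^ 2)) : ℝ) : ℂ) =
        (((2 * b)⁻¹ : ℝ) : ℂ) := by
      rw [← integral_complex_ofReal]
      push_cast
      exact this
    exact_mod_cast h2
  have hb4 : 4 * A / ‖κ‖ / (p ^ 2).re = 2 * A / ‖κ‖ * (2 * b)⁻¹ := by
    rw [hb, re_sq_div_four]; field_simp
  rw [hb4, ← hG]
  refine norm_integral_le_of_norm_le ?_ ?_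
  · exact ((integrable_mul_exp_neg_mul_sq hc).const_mul _).integrableOn
  · refine (ae_restrict_iff' measurableSet_Ioi).2 (ae_of_all _ fun x hx => ?_)
    have hx0 : 0 < x := hx
    have hne := sq_sub_sq_ne_zero_of_im him x
    have e1 : 2 * κ * ((x : ℂ) ^ 2 - κ ^ 2)⁻¹ * Complex.exp (-(p ^ 2 / 4) * x ^ 2) +
        2 / κ * Complex.exp (-(p ^ 2 / 4) * x ^ 2) =
        2 / κ * ((x : ℂ) ^ 2 * ((x : ℂ) ^ 2 - κ ^ 2)⁻¹) *
          Complex.exp (-(p ^ 2 / 4) * x ^ 2) := by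
      field_simp
      ring
    rw [e1, norm_mul, norm_mul, norm_mul, norm_div, norm_pow, Complex.norm_ofNat,
      Complex.norm_real, Real.norm_of_nonneg hx0.le, norm_cexp_neg_mul_sq, ← hb]
    -- a power of `x` is kept, as boundedness alone would only give `O(|p|⁻¹)`
    have h3 : x ^ 2 * (1 + x ^ 2)⁻¹ ≤ x := by
      rw [← div_eq_mul_inv, div_le_iff₀ (by positivity)]
      nlinarith [mul_nonneg hx0.le (sq_nonneg (x - 1)), mul_pos hx0 hx0]
    calc _ ≤ 2 / ‖κ‖ * (x ^ 2 * (A * (1 + x ^ 2)⁻¹)) * Real.exp (-b * x ^ 2) := by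
          gcongr; exact hA x
      _ = 2 * A / ‖κ‖ * ((x ^ 2 * (1 + x ^ 2)⁻¹) * Real.exp (-b * x ^ 2)) := by ring
      _ ≤ _ := by gcongr

/-! ### The Ecalle kernel of order 1 -/

/-- Values of `Γ` at the negative half-integers. -/
theorem Gamma_half_sub_nat (m : ℕ) :
    Complex.Gamma (1 / 2 - m) * ((2 * m).factorial : ℂ) =
      (-4) ^ m * (m.factorial : ℂ) * (Real.sqrt Real.pi : ℂ) := by
  induction m with
  | zero =>
    have := Complex.Gamma_one_half_eq
    simp only [Nat.cast_zero, sub_zero, this, Nat.factorial_zero, mul_zero, Nat.cast_one, mul_one,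
      pow_zero, one_mul]
    rw [Real.sqrt_eq_rpow, Complex.ofReal_cpow Real.pi_pos.le]
    norm_num
  | succ m ih =>
    have hne : (1 / 2 - ((m + 1 : ℕ) : ℂ)) ≠ 0 := by
      intro h
      have h2 : ((2 * (m + 1) : ℕ) : ℂ) = ((1 : ℕ) : ℂ) := by
        push_cast at h ⊢; linear_combination (-2) * h
      have := Nat.cast_injective (R := ℂ) h2
      omega
    have h := Complex.Gamma_add_one _ hne
    rw [show (1 / 2 - ((m + 1 : ℕ) : ℂ)) + 1 = 1 / 2 - m by push_cast; ring] at h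
    rw [h] at ih
    rw [show 2 * (m + 1) = 2 * m + 1 + 1 by ring, Nat.factorial_succ, Nat.factorial_succ,
      Nat.factorial_succ, pow_succ]
    push_cast at ih ⊢
    linear_combination (-4) * ((m : ℂ) + 1) * ih

/-- For `α = 2` the odd terms of the kernel sit at poles of `Γ`, and the even ones sum to a
Gaussian, so that the Ecalle operator is a heat integral. -/
theorem ecalleKernel_two (τ : ℂ) :
    ecalleKernel 2 τ = Complex.exp (-τ ^ 2 / 4) / (Real.sqrt Real.pi : ℂ) := by
  have hpi : (Real.sqrt Real.pi : ℂ) ≠ 0 := by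
    exact_mod_cast (Real.sqrt_pos.2 Real.pi_pos).ne'
  have hinj : Function.Injective (fun n : ℕ => 2 * n) := fun a b h => by simpa using h
  have h := (NormedSpace.expSeries_div_hasSum_exp (-τ ^ 2 / 4)).div_const (Real.sqrt Real.pi : ℂ)
  rw [← Complex.exp_eq_exp_ℂ] at h
  refine ((hinj.hasSum_iff ?_).1 (h.congr_fun ?_)).tsum_eq
  · intro n hn
    obtain ⟨m, rfl⟩ : Odd n := by
      by_contra h
      rw [Nat.not_odd_iff_even] at h
      obtain ⟨m, rfl⟩ := h
      exact hn ⟨m, by simp; ring⟩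
    have : (1 - (((2 * m + 1 : ℕ) : ℂ) + 1) / ((2 : ℝ) : ℂ)) = -(m : ℂ) := by push_cast; ring
    rw [this, Complex.Gamma_neg_nat_eq_zero, mul_zero, div_zero]
  · intro m
    have e : (1 - (((2 * m : ℕ) : ℂ) + 1) / ((2 : ℝ) : ℂ)) = 1 / 2 - m := by push_cast; ring
    have hG := Gamma_half_sub_nat m
    have hm : (m.factorial : ℂ) ≠ 0 := Nat.cast_ne_zero.2 m.factorial_ne_zero
    simp only [Function.comp]
    rw [e, mul_comm ((2 * m).factorial : ℂ), hG, pow_mul, neg_sq, div_pow]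
    have h4 : (-4 : ℂ) ^ m * (-1) ^ m = 4 ^ m := by rw [← mul_pow]; norm_num
    have h5 : (-4 : ℂ) ^ m ≠ 0 := pow_ne_zero _ (by norm_num)
    have h6 : (4 : ℂ) ^ m ≠ 0 := pow_ne_zero _ (by norm_num)
    have h7 : (-τ ^ 2) ^ m = (-1) ^ m * (τ ^ 2) ^ m := by rw [← mul_pow]; congr 1; ring
    rw [h7]
    field_simp
    rw [← h4]
    ring

/-! ### The formal solution and its Borel transform -/

/-- The formal solution is `∑ φ⁽²ⁿ⁾(z) tⁿ / n!` near `z = 0`. -/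
theorem IsFormalSolution.eq_iteratedDeriv {φ : ℂ → ℂ} {uh : ℕ → ℂ → ℂ}
    (huh : IsFormalSolution φ uh) : ∃ ρ : ℝ, 0 < ρ ∧
      (∀ n, DifferentiableOn ℂ (uh n) (disc ρ)) ∧
      ∀ n : ℕ, ∀ z ∈ disc ρ, uh n z = iteratedDeriv (2 * n) φ z / (n.factorial : ℂ) := by
  obtain ⟨ρ, hρ, hd, h0, hrec⟩ := huh
  refine ⟨ρ, hρ, hd, fun n => ?_⟩
  induction n with
  | zero => intro z hz; simpa using h0 z hz
  | succ n ih =>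
    intro z hz
    have hn : (n : ℂ) + 1 ≠ 0 := by exact_mod_cast n.succ_ne_zero
    have hev : uh n =ᶠ[𝓝 z] fun z => iteratedDeriv (2 * n) φ z / (n.factorial : ℂ) := by
      filter_upwards [Metric.isOpen_ball.mem_nhds hz] with y hy using ih y hy
    have h2 : iteratedDeriv 2 (uh n) z =
        iteratedDeriv (2 * (n + 1)) φ z / (n.factorial : ℂ) := by
      rw [hev.iteratedDeriv_eq 2, iteratedDeriv_succ, iteratedDeriv_one]
      have h1 : deriv (fun z => iteratedDeriv (2 * n) φ z / (n.factorial : ℂ)) =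
          fun z => iteratedDeriv (2 * n + 1) φ z / (n.factorial : ℂ) := by
        ext y
        rw [deriv_div_const, iteratedDeriv_succ]
      rw [h1, deriv_div_const, ← iteratedDeriv_succ, show 2 * (n + 1) = 2 * n + 1 + 1 by ring]
    have h := hrec n z hz
    rw [h2] at h
    rw [Nat.factorial_succ]
    push_cast
    apply mul_left_cancel₀ hn
    rw [h]
    field_simp

/-- The Borel transform of the formal solution with initial value `a / (z - z₀) + f z`. In terms of
`s = σ ^ 2` it is `(φ(z + σ) + φ(z - σ)) / 2`; the polar part is written as a rational function
of `s`. -/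
def heatBorel (f : ℂ → ℂ) (a z₀ s z : ℂ) : ℂ :=
  evenPart f s z + a * (z - z₀) / ((z - z₀) ^ 2 - s)

theorem heatBorel_sq {f φ : ℂ → ℂ} (hf : Differentiable ℂ f) {a z₀ : ℂ}
    (hφ : ∀ z, φ z = a / (z - z₀) + f z) {σ z : ℂ} (h : (z - z₀) ^ 2 - σ ^ 2 ≠ 0) :
    heatBorel f a z₀ (σ ^ 2) z = (φ (z + σ) + φ (z - σ)) / 2 := by
  have hfac : (z - z₀) ^ 2 - σ ^ 2 = (z + σ - z₀) * (z - σ - z₀) := by ring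
  have h' := h
  rw [hfac] at h'
  have h1 := left_ne_zero_of_mul h'
  have h2 := right_ne_zero_of_mul h'
  rw [heatBorel, evenPart_sq hf, hφ, hφ, hfac]
  field_simp
  ring

/-- On the ray `σ = x e^{iθ/2}` the denominator of the Borel transform is, up to a factor of
modulus `1`, of the form `x² - κ²` with `κ = (z₀ - z) e^{-iθ/2}`. -/
theorem sq_sub_sq_ray_eq (z₀ z : ℂ) (θ : ℝ) (x : ℝ) :
    (z - z₀) ^ 2 - (x * halfDir θ) ^ 2 =
      -(halfDir θ ^ 2 * ((x : ℂ) ^ 2 - ((z₀ - z) / halfDir θ) ^ 2)) := by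
  have := halfDir_ne_zero θ
  field_simp
  ring

theorem sq_sub_sq_ray_ne_zero {z₀ z : ℂ} {θ : ℝ} (h : ((z₀ - z) / halfDir θ).im ≠ 0) (x : ℝ) :
    (z - z₀) ^ 2 - (x * halfDir θ) ^ 2 ≠ 0 := by
  rw [sq_sub_sq_ray_eq]
  exact neg_ne_zero.2 (mul_ne_zero (pow_ne_zero _ (halfDir_ne_zero θ))
    (sq_sub_sq_ne_zero_of_im h x))

theorem mem_borelSector_iff {d ε : ℝ} {s : ℂ} : s ∈ borelSector d ε ↔
    ∃ x θ : ℝ, 0 < x ∧ |θ - d| < ε / 2 ∧ s = (x * halfDir θ) ^ 2 := by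
  constructor
  · rintro ⟨x, θ, hx, hθ, rfl⟩
    refine ⟨Real.sqrt x, θ, Real.sqrt_pos.2 hx, hθ, ?_⟩
    rw [mul_pow, halfDir_sq, ← Complex.ofReal_pow, Real.sq_sqrt hx.le]
  · rintro ⟨x, θ, hx, hθ, rfl⟩
    refine ⟨x ^ 2, θ, by positivity, hθ, ?_⟩
    rw [mul_pow, halfDir_sq, Complex.ofReal_pow]

theorem isGevreyOne_formal {f φ : ℂ → ℂ} (hf : Differentiable ℂ f) {a z₀ : ℂ} (hz₀ : z₀ ≠ 0)
    (hφ : ∀ z, φ z = a / (z - z₀) + f z) {uh : ℕ → ℂ → ℂ} {ρ : ℝ}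
    (hd : ∀ n, DifferentiableOn ℂ (uh n) (disc ρ))
    (huh : ∀ n : ℕ, ∀ z ∈ disc ρ, uh n z = iteratedDeriv (2 * n) φ z / (n.factorial : ℂ))
    (hρ : ρ ≤ ‖z₀‖ / 4) : IsGevreyOne uh ρ := by
  have hz : 0 < ‖z₀‖ := norm_pos_iff.2 hz₀
  have hφd : ∀ z ∈ Metric.ball (0 : ℂ) ‖z₀‖, DifferentiableAt ℂ φ z := by
    intro z hz
    have hne : z - z₀ ≠ 0 := by
      intro h
      rw [sub_eq_zero] at h
      simp [h] at hz
    rw [show φ = fun z => a / (z - z₀) + f z from funext hφ]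
    have := hf z
    fun_prop (disch := assumption)
  have hcb : Metric.closedBall (0 : ℂ) (‖z₀‖ / 2) ⊆ Metric.ball 0 ‖z₀‖ :=
    Metric.closedBall_subset_ball (by linarith)
  obtain ⟨M, hM⟩ := (isCompact_closedBall (0 : ℂ) (‖z₀‖ / 2)).exists_bound_of_continuousOn
    (f := φ) (fun z hz => (hφd z (hcb hz)).continuousAt.continuousWithinAt)
  refine ⟨hd, |M| + 1, 4 * (16 / ‖z₀‖ ^ 2), by positivity, by positivity, fun n z hz' => ?_⟩
  have hzn : ‖z‖ < ‖z₀‖ / 4 := by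
    have : ‖z‖ < ρ := by simpa [disc] using hz'
    linarith
  have hsub : Metric.closedBall z (‖z₀‖ / 4) ⊆ Metric.closedBall 0 (‖z₀‖ / 2) := by
    intro y hy
    simp only [Metric.mem_closedBall, dist_eq_norm, sub_zero] at hy ⊢
    have := norm_add_le (y - z) z
    rw [sub_add_cancel] at this
    linarith
  have hdc : DiffContOnCl ℂ φ (Metric.ball z (‖z₀‖ / 4)) := by
    refine DifferentiableOn.diffContOnCl fun y hy => ?_
    exact (hφd y (hcb (hsub (Metric.closure_ball_subset_closedBall hy)))).differentiableWithinAt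
  have hb := Complex.norm_iteratedDeriv_le_of_forall_mem_sphere_norm_le (C := |M| + 1) (2 * n)
    (by positivity) hdc
    (fun y hy => by
      have := hM y (hsub (Metric.sphere_subset_closedBall hy))
      have := le_abs_self M
      linarith)
  rw [huh n z hz', norm_div, Complex.norm_natCast, div_le_iff₀ (by positivity)]
  refine hb.trans ?_
  have h16 : (‖z₀‖ / 4) ^ (2 * n) = ((16 / ‖z₀‖ ^ 2) ^ n)⁻¹ := by
    rw [pow_mul, ← inv_pow]; congr 1; field_simp; norm_num
  rw [h16, div_inv_eq_mul]
  calc ((2 * n).factorial : ℝ) * (|M| + 1) * (16 / ‖z₀‖ ^ 2) ^ n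
      ≤ (4 ^ n * (n.factorial : ℝ) ^ 2) * (|M| + 1) * (16 / ‖z₀‖ ^ 2) ^ n := by
        gcongr; exact factorial_two_mul_le n
    _ = _ := by rw [mul_pow]; ring

/-- Near `s = 0` the Borel transform of the formal solution converges to `heatBorel`. -/
theorem hasSum_heatBorel {f φ : ℂ → ℂ} (hf : Differentiable ℂ f) {a z₀ : ℂ} (hz₀ : z₀ ≠ 0)
    (hφ : ∀ z, φ z = a / (z - z₀) + f z) {uh : ℕ → ℂ → ℂ} {ρ : ℝ}
    (huh : ∀ n : ℕ, ∀ z ∈ disc ρ, uh n z = iteratedDeriv (2 * n) φ z / (n.factorial : ℂ))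
    {s z : ℂ} (hs : ‖s‖ < (‖z₀‖ / 4) ^ 2) (hzρ : z ∈ disc ρ) (hz : ‖z‖ < ‖z₀‖ / 4) :
    (z - z₀) ^ 2 - s ≠ 0 ∧
    HasSum (fun n : ℕ =>
        uh n z * (n.factorial : ℂ) / Complex.Gamma (1 + 2 * (n : ℂ)) * s ^ n)
      (heatBorel f a z₀ s z) := by
  have hzp : 0 < ‖z₀‖ := norm_pos_iff.2 hz₀
  obtain ⟨σ, rfl⟩ : ∃ σ, s = σ ^ 2 :=
    (IsAlgClosed.exists_pow_nat_eq s two_pos).imp fun _ h => h.symm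
  have hσ : ‖σ‖ < ‖z₀‖ / 4 := by
    rw [norm_pow] at hs
    exact lt_of_pow_lt_pow_left₀ 2 (by positivity) hs
  have hfar : ‖z₀‖ * (3 / 4) < ‖z - z₀‖ := by
    have := norm_sub_norm_le z₀ z
    rw [norm_sub_rev] at this
    linarith
  have hne : (z - z₀) ^ 2 - σ ^ 2 ≠ 0 := by
    intro h
    have h2 : ‖z - z₀‖ ^ 2 = ‖σ‖ ^ 2 := by
      rw [← norm_pow, ← norm_pow, sub_eq_zero.1 h]
    have : ‖σ‖ ^ 2 < ‖z - z₀‖ ^ 2 := by gcongr; linarith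
    linarith
  refine ⟨hne, ?_⟩
  have hφd : DifferentiableOn ℂ φ (Metric.ball z (‖z₀‖ / 4)) := by
    intro y hy
    have hne : y - z₀ ≠ 0 := by
      intro h
      rw [sub_eq_zero] at h
      rw [h, Metric.mem_ball, dist_eq_norm, norm_sub_rev] at hy
      linarith
    rw [show φ = fun z => a / (z - z₀) + f z from funext hφ]
    have := hf y
    exact DifferentiableAt.differentiableWithinAt (by fun_prop (disch := assumption))
  rw [heatBorel_sq hf hφ hne]
  refine (hasSum_even_taylor hφd hσ).congr_fun fun n => ?_
  have hG : Complex.Gamma (1 + 2 * (n : ℂ)) = ((2 * n).factorial : ℂ) := by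
    rw [← Complex.Gamma_nat_eq_factorial]; congr 1; push_cast; ring
  have hn : (n.factorial : ℂ) ≠ 0 := Nat.cast_ne_zero.2 n.factorial_ne_zero
  rw [huh n z hzρ, hG, div_mul_cancel₀ _ hn]

/-- The Borel transform continues to every sector whose directions `e^{iθ/2}` stay away from
`± (z₀ - z)`, uniformly in `z`; there the polar part is bounded, and the entire part is of
exponential order `1` in `s` since `f` is of order `2`. -/
theorem isBorelTransform_heatBorel {f φ : ℂ → ℂ} (hf : IsEntireOfOrderTwo f) {a z₀ : ℂ}
    (hz₀ : z₀ ≠ 0) (hφ : ∀ z, φ z = a / (z - z₀) + f z) {uh : ℕ → ℂ → ℂ} {ρ : ℝ}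
    (hd : ∀ n, DifferentiableOn ℂ (uh n) (disc ρ))
    (huh : ∀ n : ℕ, ∀ z ∈ disc ρ, uh n z = iteratedDeriv (2 * n) φ z / (n.factorial : ℂ))
    (hρ : ρ ≤ ‖z₀‖ / 4) (hρ1 : ρ ≤ 1) {d ε c : ℝ} (hc : 0 < c)
    (him : ∀ θ : ℝ, |θ - d| < ε / 2 → ∀ z ∈ disc ρ, c ≤ |((z₀ - z) / halfDir θ).im|) :
    IsBorelTransform uh d ε ρ (heatBorel f a z₀) := by
  have hzp : 0 < ‖z₀‖ := norm_pos_iff.2 hz₀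
  have hsmall : ∀ z ∈ disc ρ, ‖z‖ < ρ := fun z hz => by simpa [disc] using hz
  have him0 : ∀ θ : ℝ, |θ - d| < ε / 2 → ∀ z ∈ disc ρ, ((z₀ - z) / halfDir θ).im ≠ 0 :=
    fun θ hθ z hz => abs_pos.1 (hc.trans_le (him θ hθ z hz))
  refine ⟨isGevreyOne_formal hf.1 hz₀ hφ hd huh hρ, ⟨(‖z₀‖ / 4) ^ 2, by positivity, ?_, ?_⟩, ?_⟩
  · intro s hs z hz
    exact (hasSum_heatBorel hf.1 hz₀ hφ huh hs hz ((hsmall z hz).trans_le hρ)).2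
  · have h1 := hf.differentiableOn_evenPart.mono (t := univ ×ˢ Metric.ball (0 : ℂ) 1)
      (s := (Metric.ball 0 ((‖z₀‖ / 4) ^ 2) ∪ borelSector d ε) ×ˢ disc ρ)
      (prod_mono (subset_univ _) (Metric.ball_subset_ball hρ1))
    refine h1.add ?_
    rintro ⟨s, z⟩ ⟨hs, hz⟩
    have hne : (z - z₀) ^ 2 - s ≠ 0 := by
      rcases hs with hs | hs
      · exact (hasSum_heatBorel hf.1 hz₀ hφ huh (by simpa using hs) hz
          ((hsmall z hz).trans_le hρ)).1
      · obtain ⟨x, θ, hx, hθ, hs⟩ := mem_borelSector_iff.1 hs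
        have hs : s = (x * halfDir θ) ^ 2 := hs
        rw [hs]
        exact sq_sub_sq_ray_ne_zero (him0 θ hθ z hz) x
    exact DifferentiableAt.differentiableWithinAt (by fun_prop (disch := assumption))
  · intro ε' _ hε'
    obtain ⟨-, C₁, C₂, hC₁, hC₂, hle⟩ := id hf
    refine ⟨C₁ * Real.exp (2 * C₂) + ‖a‖ * (‖z₀‖ + 1) / c ^ 2, 2 * C₂, by positivity,
      by positivity, ?_⟩
    intro s hs z hz
    obtain ⟨x, θ, hx, hθ, rfl⟩ := mem_borelSector_iff.1 hs
    have hθ' : |θ - d| < ε / 2 := by linarith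
    have hz1 : ‖z‖ ≤ 1 := ((hsmall z hz).trans_le hρ1).le
    have hns : ‖(x : ℂ) * halfDir θ‖ = x := by
      rw [norm_mul, norm_halfDir, mul_one, Complex.norm_real, Real.norm_of_nonneg hx.le]
    have hgrow : ∀ y : ℂ, ‖y‖ ≤ 1 + x →
        ‖f y‖ ≤ C₁ * Real.exp (2 * C₂) * Real.exp (2 * C₂ * x ^ 2) := by
      intro y hy
      refine (hle y).trans ?_
      rw [mul_assoc, ← Real.exp_add]
      gcongr
      have : ‖y‖ ^ 2 ≤ (1 + x) ^ 2 := by gcongr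
      nlinarith [sq_nonneg (1 - x)]
    have h1 : ‖evenPart f ((x * halfDir θ) ^ 2) z‖ ≤
        C₁ * Real.exp (2 * C₂) * Real.exp (2 * C₂ * x ^ 2) := by
      rw [evenPart_sq hf.1, norm_div, Complex.norm_ofNat, div_le_iff₀ two_pos]
      have e1 := hgrow (z + x * halfDir θ) ((norm_add_le _ _).trans (by rw [hns]; linarith))
      have e2 := hgrow (z - x * halfDir θ) ((norm_sub_le _ _).trans (by rw [hns]; linarith))
      refine (norm_add_le _ _).trans ?_
      linarith
    have h2 : ‖a * (z - z₀) / ((z - z₀) ^ 2 - (x * halfDir θ) ^ 2)‖ ≤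
        ‖a‖ * (‖z₀‖ + 1) / c ^ 2 := by
      rw [norm_div, norm_mul, sq_sub_sq_ray_eq, norm_neg, norm_mul, norm_pow, norm_halfDir,
        one_pow, one_mul]
      have e1 : ‖z - z₀‖ ≤ ‖z₀‖ + 1 := (norm_sub_le _ _).trans (by linarith)
      have e2 : c ^ 2 ≤ ‖(x : ℂ) ^ 2 - ((z₀ - z) / halfDir θ) ^ 2‖ := by
        refine le_trans ?_ (sq_im_le_norm_sq_sub_sq _ x)
        rw [← sq_abs (Complex.im _)]
        have := him θ hθ' z hz
        gcongr
      gcongr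
    have h3 : ‖((x : ℂ) * halfDir θ) ^ 2‖ = x ^ 2 := by rw [norm_pow, hns]
    have h4 : 1 ≤ Real.exp (2 * C₂ * x ^ 2) := Real.one_le_exp (by positivity)
    rw [h3, heatBorel, add_mul]
    refine (norm_add_le _ _).trans (add_le_add h1 (h2.trans ?_))
    exact le_mul_of_one_le_right (by positivity) h4

/-! ### The heat integral and the 1-sums -/

/-- The solution of the heat equation with initial value `a / (z - z₀) + f z`, for an entire
function `f`. The sign `σ` selects the side of the pole: `σ = -1` for the directions in
`(δ, δ + 2π)` and `σ = 1` for those in `(δ + 2π, δ + 4π)`, `δ = 2 arg z₀`. -/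
def heatSol (σ : ℝ) (f : ℂ → ℂ) (a z₀ w z : ℂ) : ℂ :=
  entireSol f w z + poleSol σ a z₀ w z

/-- `heatSol` is given by the heat integral along any ray which leaves the pole on the side
prescribed by `σ`. -/
theorem exists_heatSol_eq_integral {f : ℂ → ℂ} (hf : IsEntireOfOrderTwo f) :
    ∃ K : ℝ, 0 < K ∧ ∀ {φ : ℂ → ℂ} {a z₀ : ℂ} {σ : ℝ}, (∀ z, φ z = a / (z - z₀) + f z) →
      (σ = 1 ∨ σ = -1) → ∀ (θ : ℝ) (w z : ℂ), w ≠ 0 → 0 < (halfDir θ / w).re →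
      K < ((halfDir θ / w) ^ 2).re → z ∈ Metric.ball (0 : ℂ) 1 →
      0 < σ * ((z₀ - z) / halfDir θ).im →
      IntegrableOn (heatIntegrand φ θ w z) (Ioi 0) ∧
      heatSol σ f a z₀ w z = (2 * (Real.sqrt Real.pi : ℂ) * w)⁻¹ *
        ∫ x in Ioi (0 : ℝ), heatIntegrand φ θ w z x := by
  obtain ⟨K, hK, H⟩ := hf.exists_integral_eq_entireSol
  refine ⟨K, hK, fun {φ a z₀ σ} hφ hσ θ w z hw hp hp2 hz him => ?_⟩
  have hpi : (Real.sqrt Real.pi : ℂ) ≠ 0 := by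
    exact_mod_cast (Real.sqrt_pos.2 Real.pi_pos).ne'
  have he := halfDir_ne_zero θ
  set e := halfDir θ with hedef
  set p := e / w with hpdef
  set κ := (z₀ - z) / e with hκdef
  have hp0 : p ≠ 0 := div_ne_zero he hw
  have him0 : κ.im ≠ 0 := by rintro h; simp [h] at him
  have hp2' : 0 < (p ^ 2).re := hK.trans hp2
  have hc : 0 < (p ^ 2 / 4).re := by rw [re_sq_div_four]; positivity
  obtain ⟨hint, hval⟩ := H e p z (norm_halfDir θ) hp hp2 hz
  have hint2 := (integrable_pole_gaussian him0 hc).integrableOn (s := Ioi (0 : ℝ))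
  have hval2 := integral_pole_gaussian hσ him hp hp2'
  have hform : heatIntegrand φ θ w z = fun x : ℝ =>
      e * ((f (z + x * e) + f (z - x * e)) * Complex.exp (-(p ^ 2 / 4) * x ^ 2)) +
      a * (2 * κ * ((x : ℂ) ^ 2 - κ ^ 2)⁻¹ * Complex.exp (-(p ^ 2 / 4) * x ^ 2)) := by
    ext x
    have hexp : -(x * e) ^ 2 / (4 * w ^ 2) = -(p ^ 2 / 4) * x ^ 2 := by
      rw [hpdef]; field_simp
    have hpole : (a / (z + x * e - z₀) + a / (z - x * e - z₀)) * e =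
        a * (2 * κ * ((x : ℂ) ^ 2 - κ ^ 2)⁻¹) := by
      have h0 := sq_sub_sq_ne_zero_of_im him0 x
      have hz0 : z₀ = z + κ * e := by rw [hκdef, div_mul_cancel₀ _ he]; ring
      rw [sq_sub_sq] at h0 ⊢
      have h1 := left_ne_zero_of_mul h0
      have h2 := right_ne_zero_of_mul h0
      rw [show z + x * e - z₀ = (x - κ) * e by rw [hz0]; ring,
        show z - x * e - z₀ = -((x + κ) * e) by rw [hz0]; ring]
      field_simp
      ring
    simp only [heatIntegrand]
    rw [show Complex.exp (Complex.I * (θ / 2 : ℝ)) = e from rfl, hexp, hφ, hφ]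
    linear_combination Complex.exp (-(p ^ 2 / 4) * x ^ 2) * hpole
  rw [hform]
  refine ⟨(hint.const_mul e).add (hint2.const_mul a), ?_⟩
  rw [integral_add (hint.const_mul e) (hint2.const_mul a), integral_const_mul,
    integral_const_mul, hval, hval2, heatSol, poleSol]
  have e1 : e / p = w := by rw [hpdef]; field_simp
  have e2 : κ * p = (z₀ - z) / w := by rw [hκdef, hpdef]; field_simp
  have e3 : e = p * w := by rw [hpdef]; field_simp
  rw [e1, e2]
  rw [e3]
  field_simp

/-- The condition that the ray of direction `e^{iθ/2}` leaves the pole `z₀` on the side prescribed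
by `σ` is stable. -/
theorem exists_margin {σ : ℝ} {z₀ : ℂ} {θ : ℝ} (h : 0 < σ * (z₀ / halfDir θ).im) :
    ∃ ε ρ c : ℝ, 0 < ε ∧ 0 < ρ ∧ 0 < c ∧ ∀ θ' : ℝ, |θ' - θ| < ε / 2 → ∀ z : ℂ, ‖z‖ < ρ →
      c ≤ σ * ((z₀ - z) / halfDir θ').im := by
  have hcont : Continuous fun q : ℝ × ℂ => σ * ((z₀ - q.2) / halfDir q.1).im := by
    have := continuous_halfDir
    refine continuous_const.mul (Complex.continuous_im.comp ?_)
    exact Continuous.div (by fun_prop) (by fun_prop) fun q => halfDir_ne_zero _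
  have hev : ∀ᶠ q : ℝ × ℂ in 𝓝 (θ, 0), σ * (z₀ / halfDir θ).im / 2 <
      σ * ((z₀ - q.2) / halfDir q.1).im := by
    refine hcont.continuousAt.eventually_const_lt ?_
    simp only [sub_zero]
    linarith
  obtain ⟨R, hR, hball⟩ := Metric.eventually_nhds_iff.1 hev
  refine ⟨R, R, σ * (z₀ / halfDir θ).im / 2, hR, hR, by positivity, fun θ' hθ' z hz => ?_⟩
  refine (hball (y := (θ', z)) ?_).le
  rw [Prod.dist_eq, max_lt_iff, Real.dist_eq, dist_zero_right]
  exact ⟨by linarith, hz⟩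

theorem isHeatIntegral_heatSol {f φ : ℂ → ℂ} (hf : IsEntireOfOrderTwo f) {a z₀ : ℂ}
    (hφ : ∀ z, φ z = a / (z - z₀) + f z) {σ : ℝ} (hσ : σ = 1 ∨ σ = -1) {θ : ℝ}
    (hθ : 0 < σ * (z₀ / halfDir θ).im) : IsHeatIntegral φ θ (heatSol σ f a z₀) := by
  obtain ⟨K, hK, H⟩ := exists_heatSol_eq_integral hf
  obtain ⟨ε, ρ, c, hε, hρ, hc, hm⟩ := exists_margin hθ
  intro η hη hηpi
  have hsin : 0 < Real.sin (η / 2) := Real.sin_pos_of_pos_of_lt_pi (by linarith) (by linarith)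
  refine ⟨Real.sin (η / 2) / K, min ρ 1, by positivity, by positivity, fun w hw z hz => ?_⟩
  obtain ⟨hw0, hwr, hp, hp2⟩ := re_halfDir_div hη hηpi hw
  have hzn : ‖z‖ < min ρ 1 := by simpa [disc] using hz
  refine H hφ hσ θ w z hw0 hp (lt_of_lt_of_le ?_ hp2) ?_ ?_
  · rw [lt_div_iff₀ (by positivity)]
    rwa [lt_div_iff₀ hK, mul_comm] at hwr
  · simpa using hzn.trans_le (min_le_right _ _)
  · exact hc.trans_le (hm θ (by simpa using hε) z (hzn.trans_le (min_le_left _ _)))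

/-- The Ecalle operator applied to the Borel transform is the heat integral. -/
theorem ecalleIntegrand_heatBorel {f φ : ℂ → ℂ} (hf : Differentiable ℂ f) {a z₀ : ℂ}
    (hφ : ∀ z, φ z = a / (z - z₀) + f z) {θ : ℝ} {w z : ℂ}
    (him : ((z₀ - z) / halfDir θ).im ≠ 0) :
    ecalleIntegrand (heatBorel f a z₀) θ w z =
      fun x => (2 * (Real.sqrt Real.pi : ℂ))⁻¹ * heatIntegrand φ θ w z x := by
  ext x
  have hpi : (Real.sqrt Real.pi : ℂ) ≠ 0 := by
    exact_mod_cast (Real.sqrt_pos.2 Real.pi_pos).ne'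
  have h1 : (x : ℂ) ^ 2 * Complex.exp (Complex.I * θ) = (x * halfDir θ) ^ 2 := by
    rw [mul_pow, halfDir_sq]
  simp only [ecalleIntegrand, heatIntegrand]
  rw [h1, heatBorel_sq hf hφ (sq_sub_sq_ray_ne_zero him x), ecalleKernel_two]
  rw [show Complex.exp (Complex.I * (θ / 2 : ℝ)) = halfDir θ from rfl]
  rw [show -(x * halfDir θ / w) ^ 2 / 4 = -(x * halfDir θ) ^ 2 / (4 * w ^ 2) by
    rw [div_pow]; ring]
  field_simp

theorem IsHolomorphicOn.left {u : ℂ → ℂ → ℂ} {V : Set ℂ} {ρ : ℝ} (h : IsHolomorphicOn u V ρ)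
    {z : ℂ} (hz : z ∈ disc ρ) : DifferentiableOn ℂ (fun w => u w z) V := by
  have hι : DifferentiableOn ℂ (fun w : ℂ => (w, z)) V := by fun_prop
  exact DifferentiableOn.comp (g := fun p : ℂ × ℂ => u p.1 p.2) h hι fun w hw => ⟨hw, hz⟩

theorem IsHolomorphicOn.right {u : ℂ → ℂ → ℂ} {V : Set ℂ} {ρ : ℝ} (h : IsHolomorphicOn u V ρ)
    {w : ℂ} (hw : w ∈ V) : DifferentiableOn ℂ (fun z => u w z) (disc ρ) := by
  have hι : DifferentiableOn ℂ (fun z : ℂ => (w, z)) (disc ρ) := by fun_prop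
  exact DifferentiableOn.comp (g := fun p : ℂ × ℂ => u p.1 p.2) h hι fun z hz => ⟨hw, hz⟩

theorem isOneSum_heatSol {f φ : ℂ → ℂ} (hf : IsEntireOfOrderTwo f) {a z₀ : ℂ} (hz₀ : z₀ ≠ 0)
    (hφ : ∀ z, φ z = a / (z - z₀) + f z) {uh : ℕ → ℂ → ℂ} (huh : IsFormalSolution φ uh)
    {σ : ℝ} (hσ : σ = 1 ∨ σ = -1) {θ : ℝ}
    (hθ : 0 < σ * (z₀ / halfDir θ).im) : IsOneSum uh θ (heatSol σ f a z₀) := by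
  obtain ⟨K, hK, H⟩ := exists_heatSol_eq_integral hf
  obtain ⟨ε, ρ, c, hε, hρ, hc, hm⟩ := exists_margin hθ
  obtain ⟨ρ₁, hρ₁, hd, hder⟩ := huh.eq_iteratedDeriv
  have hzp : 0 < ‖z₀‖ := norm_pos_iff.2 hz₀
  obtain ⟨ρ', hρ', h1, h2, h3, h4⟩ : ∃ ρ' : ℝ, 0 < ρ' ∧ ρ' ≤ ρ ∧ ρ' ≤ ρ₁ ∧ ρ' ≤ ‖z₀‖ / 4 ∧
      ρ' ≤ 1 :=
    ⟨min (min ρ ρ₁) (min (‖z₀‖ / 4) 1), by positivity, (min_le_left _ _).trans (min_le_left _ _),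
      (min_le_left _ _).trans (min_le_right _ _), (min_le_right _ _).trans (min_le_left _ _),
      (min_le_right _ _).trans (min_le_right _ _)⟩
  have hsub : disc ρ' ⊆ disc ρ₁ := Metric.ball_subset_ball h2
  have hzn : ∀ z ∈ disc ρ', ‖z‖ < ρ' := fun z hz => by simpa [disc] using hz
  refine ⟨ε, ρ', hε, hρ', heatBorel f a z₀, ?_, ?_⟩
  · refine isBorelTransform_heatBorel hf hz₀ hφ (fun n => (hd n).mono hsub)
      (fun n z hz => hder n z (hsub hz)) h3 h4 hc fun θ' hθ' z hz => ?_
    refine (hm θ' hθ' z ((hzn z hz).trans_le h1)).trans ((le_abs_self _).trans ?_)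
    rw [abs_mul]
    rcases hσ with rfl | rfl <;> simp
  · intro θ' hθ' η hη hηpi
    have hsin : 0 < Real.sin (η / 2) := Real.sin_pos_of_pos_of_lt_pi (by linarith) (by linarith)
    refine ⟨Real.sin (η / 2) / K, by positivity, fun w hw z hz => ?_⟩
    obtain ⟨hw0, hwr, hp, hp2⟩ := re_halfDir_div hη hηpi hw
    have hpos := hc.trans_le (hm θ' hθ' z ((hzn z hz).trans_le h1))
    obtain ⟨hint, hval⟩ := H hφ hσ θ' w z hw0 hp (lt_of_lt_of_le (by
      rw [lt_div_iff₀ (by positivity)]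
      rwa [lt_div_iff₀ hK, mul_comm] at hwr) hp2)
      (by simpa using (hzn z hz).trans_le h4) hpos
    have him : ((z₀ - z) / halfDir θ').im ≠ 0 := by rintro h; simp [h] at hpos
    rw [ecalleIntegrand_heatBorel hf.1 hφ him]
    refine ⟨hint.const_mul _, ?_⟩
    rw [hval, integral_const_mul, mul_inv]
    ring

theorem IsOneSum.isSummableInDirection {b : ℕ → ℂ → ℂ} {d : ℝ} {u : ℂ → ℂ → ℂ}
    (h : IsOneSum b d u) : IsSummableInDirection b d := by
  obtain ⟨ε, ρ, hε, hρ, g, hg, -⟩ := h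
  exact ⟨ε, ρ, hε, hρ, g, hg⟩

/-- The Borel transform has a pole at `s = z₀²` for `z = 0`. -/
theorem not_isSummableInDirection {f φ : ℂ → ℂ} (hf : IsEntireOfOrderTwo f) {a z₀ : ℂ}
    (ha : a ≠ 0) (hz₀ : z₀ ≠ 0) (hφ : ∀ z, φ z = a / (z - z₀) + f z) {uh : ℕ → ℂ → ℂ}
    (huh : IsFormalSolution φ uh) {d : ℝ}
    (hd : z₀ ^ 2 = (‖z₀‖ * halfDir d) ^ 2) : ¬ IsSummableInDirection uh d := by
  rintro ⟨ε, ρ, hε, hρ, g, hg⟩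
  obtain ⟨R, hR, hsum, hhol⟩ := hg.near_zero
  obtain ⟨ρ₁, hρ₁, -, hder⟩ := huh.eq_iteratedDeriv
  have hzp : 0 < ‖z₀‖ := norm_pos_iff.2 hz₀
  have h0 : (0 : ℂ) ∈ disc ρ := Metric.mem_ball_self hρ
  set U := Metric.ball (0 : ℂ) R ∪ borelSector d ε with hU
  have hUo : IsOpen U := Metric.isOpen_ball.union (isOpen_borelSector d ε)
  have hgd : DifferentiableOn ℂ (fun s => g s 0) U := IsHolomorphicOn.left hhol h0
  have hev : IsHolomorphicOn (evenPart f) univ 1 := hf.differentiableOn_evenPart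
  have hed : DifferentiableOn ℂ (fun s => evenPart f s 0) U :=
    (hev.left (Metric.mem_ball_self one_pos)).mono (subset_univ U)
  -- clearing the pole gives a function of `s` which is constant near `0`, hence on all of `U`
  have hF : DifferentiableOn ℂ (fun s => (z₀ ^ 2 - s) * (g s 0 - evenPart f s 0)) U :=
    DifferentiableOn.mul (by fun_prop) (hgd.sub hed)
  have hC : DifferentiableOn ℂ (fun _ : ℂ => -(a * z₀)) U := by fun_prop
  have heq := (hF.analyticOnNhd hUo).eqOn_of_preconnected_of_eventuallyEq
    (hC.analyticOnNhd hUo) (isPreconnected_ball_union_borelSector d ε hR)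
    (z₀ := 0) (Or.inl (Metric.mem_ball_self hR)) ?_
  · have hmem : z₀ ^ 2 ∈ U :=
      Or.inr (mem_borelSector_iff.2 ⟨‖z₀‖, d, hzp, by simpa using hε, hd⟩)
    have := heq hmem
    simp only [sub_self, zero_mul] at this
    exact mul_ne_zero ha hz₀ (neg_eq_zero.1 this.symm)
  · filter_upwards [Metric.ball_mem_nhds (0 : ℂ) (lt_min hR (by positivity : 0 < (‖z₀‖ / 4) ^ 2))]
      with s hs
    have hs' : ‖s‖ < min R ((‖z₀‖ / 4) ^ 2) := by simpa using hs
    obtain ⟨hne, h⟩ := hasSum_heatBorel hf.1 hz₀ hφ hder (hs'.trans_le (min_le_right _ _))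
      (Metric.mem_ball_self hρ₁ : (0 : ℂ) ∈ disc ρ₁) (by simpa using hzp)
    rw [(hsum s (hs'.trans_le (min_le_left _ _)) 0 h0).unique h, heatBorel]
    simp only [zero_sub, neg_sq] at hne ⊢
    field_simp
    ring

/-- The Borel transform, hence the `1`-sum, in a given direction is unique. -/
theorem IsOneSum.eqOn {b : ℕ → ℂ → ℂ} {d : ℝ} {u u' : ℂ → ℂ → ℂ} (h : IsOneSum b d u)
    (h' : IsOneSum b d u') : ∃ r ρ : ℝ, 0 < r ∧ 0 < ρ ∧
      ∀ w ∈ sector d (Real.pi / 2) r, ∀ z ∈ disc ρ, u w z = u' w z := by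
  obtain ⟨ε, ρ, hε, hρ, g, hg, hu⟩ := h
  obtain ⟨ε', ρ', hε', hρ', g', hg', hu'⟩ := h'
  obtain ⟨R, hR, hsum, hhol⟩ := hg.near_zero
  obtain ⟨R', hR', hsum', hhol'⟩ := hg'.near_zero
  have hpi := Real.pi_pos
  obtain ⟨r, hr, hru⟩ := hu d (by simpa using hε) (Real.pi / 2) (by linarith) (by linarith)
  obtain ⟨r', hr', hru'⟩ := hu' d (by simpa using hε') (Real.pi / 2) (by linarith) (by linarith)
  have hε2 : 0 < min ε ε' := lt_min hε hε'
  have hR2 : 0 < min R R' := lt_min hR hR'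
  set U := Metric.ball (0 : ℂ) (min R R') ∪ borelSector d (min ε ε') with hU
  have hUo : IsOpen U := Metric.isOpen_ball.union (isOpen_borelSector _ _)
  have hUsub : ∀ {R₁ ε₁ : ℝ}, min R R' ≤ R₁ → min ε ε' ≤ ε₁ →
      U ⊆ Metric.ball (0 : ℂ) R₁ ∪ borelSector d ε₁ := by
    intro R₁ ε₁ h1 h2
    refine union_subset_union (Metric.ball_subset_ball h1) ?_
    rintro s ⟨x, θ, hx, hθ, rfl⟩
    exact ⟨x, θ, hx, by linarith, rfl⟩
  refine ⟨min r r', min ρ ρ', lt_min hr hr', lt_min hρ hρ', fun w hw z hz => ?_⟩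
  have hz1 : z ∈ disc ρ := Metric.ball_subset_ball (min_le_left _ _) hz
  have hz2 : z ∈ disc ρ' := Metric.ball_subset_ball (min_le_right _ _) hz
  have hd1 : DifferentiableOn ℂ (fun s => g s z) U :=
    (IsHolomorphicOn.left hhol hz1).mono (hUsub (min_le_left _ _) (min_le_left _ _))
  have hd2 : DifferentiableOn ℂ (fun s => g' s z) U :=
    (IsHolomorphicOn.left hhol' hz2).mono (hUsub (min_le_right _ _) (min_le_right _ _))
  have heq := (hd1.analyticOnNhd hUo).eqOn_of_preconnected_of_eventuallyEq
    (hd2.analyticOnNhd hUo) (isPreconnected_ball_union_borelSector d _ hR2)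
    (z₀ := 0) (Or.inl (Metric.mem_ball_self hR2)) (by
      filter_upwards [Metric.ball_mem_nhds (0 : ℂ) hR2] with s hs
      have hs' : ‖s‖ < min R R' := by simpa using hs
      exact (hsum s (hs'.trans_le (min_le_left _ _)) z hz1).unique
        (hsum' s (hs'.trans_le (min_le_right _ _)) z hz2))
  have hpi2 : Real.pi / 2 = Real.pi - Real.pi / 2 := by ring
  rw [hpi2] at hw
  rw [(hru w (sector_subset_sector le_rfl le_rfl (min_le_left _ _) hw) z hz1).2,
    (hru' w (sector_subset_sector le_rfl le_rfl (min_le_right _ _) hw) z hz2).2]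
  congr 1
  refine setIntegral_congr_fun measurableSet_Ioi fun x hx => ?_
  have hmem : (x : ℂ) ^ 2 * Complex.exp (Complex.I * d) ∈ U := by
    refine Or.inr ⟨x ^ 2, d, pow_pos hx 2, by simpa using hε2, by push_cast; rfl⟩
  have := heq hmem
  simp only [ecalleIntegrand] at this ⊢
  rw [this]

/-! ### Actual solutions -/

theorem entireSol_zero (f : ℂ → ℂ) (z : ℂ) : entireSol f 0 z = f z := by
  rw [entireSol, tsum_eq_single 0]
  · simp
  · intro n hn
    simp [hn]

/-- By the asymptotic expansion of the Cauchy integral, the polar part of the solution differs from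
`a / (z - z₀)` by `O(|w|)`. -/
theorem tendsto_poleSol {σ : ℝ} (hσ : σ = 1 ∨ σ = -1) (a : ℂ) {z₀ z : ℂ} {θ η : ℝ} (hη : 0 < η)
    (hηpi : η < Real.pi) (R : ℝ) (him : 0 < σ * ((z₀ - z) / halfDir θ).im) :
    Tendsto (fun w => poleSol σ a z₀ w z) (𝓝[sector θ (Real.pi - η) R] 0)
      (𝓝 (a / (z - z₀))) := by
  obtain ⟨A, hA, H⟩ := exists_norm_poleKernel_add_le hσ him
  have hsin : 0 < Real.sin (η / 2) := Real.sin_pos_of_pos_of_lt_pi (by linarith) (by linarith)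
  have hspi := Real.sqrt_pos.2 Real.pi_pos
  have hpi : (Real.sqrt Real.pi : ℂ) ≠ 0 := by exact_mod_cast hspi.ne'
  have hζ : z₀ - z ≠ 0 := by rintro h; simp [h] at him
  rw [tendsto_iff_norm_sub_tendsto_zero]
  refine squeeze_zero' (g := fun w : ℂ =>
      ‖a‖ / (2 * Real.sqrt Real.pi) * (A / Real.sin (η / 2)) * ‖w‖)
    (Eventually.of_forall fun w => norm_nonneg _) ?_ ?_
  · filter_upwards [self_mem_nhdsWithin] with w hw
    obtain ⟨hw0, -, hp, hp2⟩ := re_halfDir_div hη hηpi hw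
    have he := halfDir_ne_zero θ
    have hwn : 0 < ‖w‖ := norm_pos_iff.2 hw0
    have hp2' : 0 < ((halfDir θ / w) ^ 2).re := lt_of_lt_of_le (by positivity) hp2
    have h := H (halfDir θ / w) hp hp2'
    rw [div_mul_div_cancel₀ he] at h
    have h1 : poleSol σ a z₀ w z - a / (z - z₀) = a / (2 * (Real.sqrt Real.pi : ℂ) * w) *
        (poleKernel σ ((z₀ - z) / w) + 2 * (Real.sqrt Real.pi : ℂ) / ((z₀ - z) / w)) := by
      rw [poleSol, ← neg_sub z₀ z]
      field_simp
      ring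
    have h2 : A / ((halfDir θ / w) ^ 2).re ≤ A / Real.sin (η / 2) * ‖w‖ ^ 2 := by
      rw [div_le_iff₀ hp2']
      have h3 : A / Real.sin (η / 2) * ‖w‖ ^ 2 * (Real.sin (η / 2) / ‖w‖ ^ 2) = A := by
        field_simp
      calc A = _ := h3.symm
        _ ≤ _ := by gcongr
    rw [h1, norm_mul, norm_div, norm_mul, norm_mul, Complex.norm_ofNat, Complex.norm_real,
      Real.norm_of_nonneg hspi.le]
    calc _ ≤ ‖a‖ / (2 * Real.sqrt Real.pi * ‖w‖) * (A / Real.sin (η / 2) * ‖w‖ ^ 2) := by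
          gcongr; exact h.trans h2
      _ = _ := by field_simp
  · have : Tendsto (fun w : ℂ => ‖a‖ / (2 * Real.sqrt Real.pi) * (A / Real.sin (η / 2)) * ‖w‖)
        (𝓝 0) (𝓝 (‖a‖ / (2 * Real.sqrt Real.pi) * (A / Real.sin (η / 2)) * ‖(0 : ℂ)‖)) :=
      Continuous.tendsto (by fun_prop) 0
    rw [norm_zero, mul_zero] at this
    exact this.mono_left nhdsWithin_le_nhds

theorem iteratedDeriv_two_add {g h : ℂ → ℂ} {U : Set ℂ} (hU : IsOpen U)
    (hg : DifferentiableOn ℂ g U) (hh : DifferentiableOn ℂ h U) {z : ℂ} (hz : z ∈ U) :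
    iteratedDeriv 2 (fun z => g z + h z) z = iteratedDeriv 2 g z + iteratedDeriv 2 h z :=
  iteratedDeriv_fun_add ((hg.contDiffOn hU).contDiffAt (hU.mem_nhds hz))
    ((hh.contDiffOn hU).contDiffAt (hU.mem_nhds hz))

theorem isOpen_surfaceDisc (r : ℝ) : IsOpen (surfaceDisc r) := by
  have h : Continuous fun w : ℂ => ‖w ^ 2‖ := by fun_prop
  exact (isOpen_lt continuous_const h).inter (isOpen_lt h continuous_const)

/-- `heatSol` is a holomorphic solution of the heat equation on a whole punctured disc of `W`, with
radius depending only on `f`. -/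
theorem exists_heatSol_holomorphic {f : ℂ → ℂ} (hf : IsEntireOfOrderTwo f) :
    ∃ r : ℝ, 0 < r ∧ ∀ (σ : ℝ) (a z₀ : ℂ),
      IsHolomorphicOn (heatSol σ f a z₀) (surfaceDisc r) 1 ∧
      (∀ w ∈ surfaceDisc r, ∀ z ∈ disc 1,
        (2 * w)⁻¹ * deriv (fun w' => heatSol σ f a z₀ w' z) w =
          iteratedDeriv 2 (fun z' => heatSol σ f a z₀ w z') z) ∧
      ∀ z ∈ disc 1, Tendsto (fun w => entireSol f w z) (𝓝 0) (𝓝 (f z)) := by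
  obtain ⟨r, hr, hhol, hheat⟩ := hf.exists_entireSol
  refine ⟨r, hr, fun σ a z₀ => ?_⟩
  have hw : ∀ w ∈ surfaceDisc r, w ≠ 0 ∧ ‖w‖ ^ 2 < r := by
    rintro w ⟨h1, h2⟩
    rw [norm_pow] at h1 h2
    exact ⟨by rintro rfl; simp at h1, h2⟩
  have hE : IsHolomorphicOn (entireSol f) (surfaceDisc r) 1 :=
    hhol.mono (prod_mono (fun w h => (hw w h).2) subset_rfl)
  have hP : IsHolomorphicOn (poleSol σ a z₀) (surfaceDisc r) 1 :=
    (differentiableOn_poleSol σ a z₀).mono (prod_mono (fun w h => (hw w h).1) (subset_univ _))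
  refine ⟨DifferentiableOn.add hE hP, fun w hwr z hz => ?_, fun z hz => ?_⟩
  · have hnhds := (isOpen_surfaceDisc r).mem_nhds hwr
    have e1 : deriv (fun w' => heatSol σ f a z₀ w' z) w =
        deriv (fun w' => entireSol f w' z) w + deriv (fun w' => poleSol σ a z₀ w' z) w :=
      deriv_fun_add ((hE.left hz).differentiableAt hnhds) ((hP.left hz).differentiableAt hnhds)
    have e2 : iteratedDeriv 2 (fun z' => heatSol σ f a z₀ w z') z =
        iteratedDeriv 2 (fun z' => entireSol f w z') z +
          iteratedDeriv 2 (fun z' => poleSol σ a z₀ w z') z :=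
      iteratedDeriv_two_add Metric.isOpen_ball (hE.right hwr) (hP.right hwr) hz
    rw [e1, e2, mul_add, hheat w z (hw w hwr).1 (hw w hwr).2 hz, poleSol_heat σ a z₀ (hw w hwr).1]
  · have hd : DifferentiableOn ℂ (fun w => entireSol f w z) {w | ‖w‖ ^ 2 < r} :=
      IsHolomorphicOn.left (ρ := 1) hhol hz
    have hopen : IsOpen {w : ℂ | ‖w‖ ^ 2 < r} := isOpen_lt (by fun_prop) continuous_const
    have h0 : (0 : ℂ) ∈ {w : ℂ | ‖w‖ ^ 2 < r} := by simpa using hr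
    have := (hd.differentiableAt (hopen.mem_nhds h0)).continuousAt.tendsto
    rwa [entireSol_zero] at this

/-- The sector of opening `3π - ε` is covered by three sectors of opening less than `π` in which
`heatSol` is given by a heat integral along a fixed ray. -/
theorem sector_subset_union {β ε r : ℝ} (hε : 0 < ε) :
    sector β (3 * Real.pi - ε) r ⊆
      sector (β - Real.pi + ε / 4) (Real.pi - ε / 8) r ∪ sector β (Real.pi - ε / 8) r ∪
        sector (β + Real.pi - ε / 4) (Real.pi - ε / 8) r := by
  rintro w ⟨x, φ, hx, hxr, hφ, rfl⟩
  rw [abs_lt] at hφ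
  have hpi := Real.pi_pos
  rcases lt_or_ge φ (β - Real.pi / 2 + ε / 8) with h1 | h1
  · left; left
    exact ⟨x, φ, hx, hxr, abs_lt.2 ⟨by linarith, by linarith⟩, rfl⟩
  · rcases lt_or_ge φ (β + Real.pi / 2 - ε / 8) with h2 | h2
    · left; right
      exact ⟨x, φ, hx, hxr, abs_lt.2 ⟨by linarith, by linarith⟩, rfl⟩
    · right
      exact ⟨x, φ, hx, hxr, abs_lt.2 ⟨by linarith, by linarith⟩, rfl⟩

/-- `heatSol` takes its initial value in the sector of opening `3π - ε` around the middle direction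
`β` of an interval of directions leaving the pole on the side prescribed by `σ`. -/
theorem exists_isActualSolution {f φ : ℂ → ℂ} {a z₀ : ℂ} (hφ : ∀ z, φ z = a / (z - z₀) + f z)
    {r₀ : ℝ} {σ : ℝ}
    (hhol : IsHolomorphicOn (heatSol σ f a z₀) (surfaceDisc r₀) 1)
    (hheat : ∀ w ∈ surfaceDisc r₀, ∀ z ∈ disc 1,
        (2 * w)⁻¹ * deriv (fun w' => heatSol σ f a z₀ w' z) w =
          iteratedDeriv 2 (fun z' => heatSol σ f a z₀ w z') z)
    (hlim : ∀ z ∈ disc 1, Tendsto (fun w => entireSol f w z) (𝓝 0) (𝓝 (f z)))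
    (hσ : σ = 1 ∨ σ = -1) {β : ℝ}
    (hβ : ∀ θ ∈ Ioo (β - Real.pi) (β + Real.pi), 0 < σ * (z₀ / halfDir θ).im) {ε : ℝ}
    (hε : 0 < ε) (hεpi : ε < Real.pi) :
    ∃ ρ₀ : ℝ, 0 < ρ₀ ∧ ∀ ρ ≤ ρ₀,
      IsActualSolution φ (sector β (3 * Real.pi - ε) r₀) ρ (heatSol σ f a z₀) := by
  have hpi := Real.pi_pos
  obtain ⟨ε₁, ρ₁, c₁, h1, hρ₁, hc₁, hm₁⟩ := exists_margin (hβ (β - Real.pi + ε / 4)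
    ⟨by linarith, by linarith⟩)
  obtain ⟨ε₂, ρ₂, c₂, h2, hρ₂, hc₂, hm₂⟩ := exists_margin (hβ β ⟨by linarith, by linarith⟩)
  obtain ⟨ε₃, ρ₃, c₃, h3, hρ₃, hc₃, hm₃⟩ := exists_margin (hβ (β + Real.pi - ε / 4)
    ⟨by linarith, by linarith⟩)
  refine ⟨min (min ρ₁ ρ₂) (min ρ₃ 1), by positivity, fun ρ hρ => ?_⟩
  have l1 : ρ ≤ ρ₁ := hρ.trans ((min_le_left _ _).trans (min_le_left _ _))
  have l2 : ρ ≤ ρ₂ := hρ.trans ((min_le_left _ _).trans (min_le_right _ _))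
  have l3 : ρ ≤ ρ₃ := hρ.trans ((min_le_right _ _).trans (min_le_left _ _))
  have l4 : disc ρ ⊆ disc 1 :=
    Metric.ball_subset_ball (hρ.trans ((min_le_right _ _).trans (min_le_right _ _)))
  have hsub := sector_subset_surfaceDisc β (3 * Real.pi - ε) r₀
  refine ⟨hhol.mono (prod_mono hsub l4), fun w hw z hz => hheat w (hsub hw) z (l4 hz),
    fun z hz => ?_⟩
  have hzn : ‖z‖ < ρ := by simpa [disc] using hz
  rw [hφ, add_comm]
  refine Tendsto.add ((hlim z (l4 hz)).mono_left nhdsWithin_le_nhds) ?_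
  refine Tendsto.mono_left ?_ (nhdsWithin_mono 0 (sector_subset_union hε))
  have hη : 0 < ε / 8 := by linarith
  have hηpi : ε / 8 < Real.pi := by linarith
  rw [nhdsWithin_union, nhdsWithin_union]
  refine (Tendsto.sup ?_ ?_).sup ?_
  · exact tendsto_poleSol hσ a hη hηpi r₀
      (hc₁.trans_le (hm₁ _ (by simpa using h1) z (hzn.trans_le l1)))
  · exact tendsto_poleSol hσ a hη hηpi r₀
      (hc₂.trans_le (hm₂ _ (by simpa using h2) z (hzn.trans_le l2)))
  · exact tendsto_poleSol hσ a hη hηpi r₀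
      (hc₃.trans_le (hm₃ _ (by simpa using h3) z (hzn.trans_le l3)))

/-- The two solutions differ by the residue of the integrand at the pole. -/
theorem heatSol_sub_heatSol (f : ℂ → ℂ) (a z₀ w z : ℂ) :
    heatSol (-1) f a z₀ w z - heatSol 1 f a z₀ w z =
      -Complex.I * ((Real.sqrt Real.pi : ℂ) / w) * a *
        Complex.exp (-(z₀ - z) ^ 2 / (4 * w ^ 2)) := by
  have hpi : (Real.sqrt Real.pi : ℂ) ≠ 0 := by
    exact_mod_cast (Real.sqrt_pos.2 Real.pi_pos).ne'
  have hpi2 : (Real.pi : ℂ) = (Real.sqrt Real.pi : ℂ) ^ 2 := by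
    rw [← Complex.ofReal_pow, Real.sq_sqrt Real.pi_pos.le]
  have he : -((z₀ - z) / w) ^ 2 / 4 = -(z₀ - z) ^ 2 / (4 * w ^ 2) := by rw [div_pow]; ring
  rw [heatSol, heatSol, poleSol, poleSol, poleKernel, poleKernel, he]
  generalize Complex.exp (-(z₀ - z) ^ 2 / (4 * w ^ 2)) = E
  rcases eq_or_ne w 0 with rfl | hw
  · simp
  · rw [hpi2]
    push_cast
    field_simp
    ring

/-! ### Singular directions -/

theorem div_halfDir_im (z₀ : ℂ) (θ : ℝ) :
    (z₀ / halfDir θ).im = ‖z₀‖ * Real.sin ((2 * z₀.arg - θ) / 2) := by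
  have h : z₀ / halfDir θ =
      (‖z₀‖ : ℂ) * Complex.exp (((2 * z₀.arg - θ) / 2 : ℝ) * Complex.I) := by
    conv_lhs => rw [← Complex.norm_mul_exp_arg_mul_I z₀]
    rw [halfDir, mul_div_assoc, ← Complex.exp_sub]
    congr 2
    push_cast
    ring
  rw [h, Complex.im_ofReal_mul, Complex.exp_ofReal_mul_I_im]

theorem im_neg_of_mem {z₀ : ℂ} (hz₀ : z₀ ≠ 0) {θ : ℝ}
    (hθ : θ ∈ Ioo (2 * z₀.arg) (2 * z₀.arg + 2 * Real.pi)) :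
    0 < (-1 : ℝ) * (z₀ / halfDir θ).im := by
  have hz : 0 < ‖z₀‖ := norm_pos_iff.2 hz₀
  rw [div_halfDir_im, show (2 * z₀.arg - θ) / 2 = -((θ - 2 * z₀.arg) / 2) by ring, Real.sin_neg]
  have := Real.sin_pos_of_pos_of_lt_pi (x := (θ - 2 * z₀.arg) / 2) (by linarith [hθ.1])
    (by linarith [hθ.2])
  nlinarith [mul_pos hz this]

theorem im_pos_of_mem {z₀ : ℂ} (hz₀ : z₀ ≠ 0) {θ : ℝ}
    (hθ : θ ∈ Ioo (2 * z₀.arg + 2 * Real.pi) (2 * z₀.arg + 4 * Real.pi)) :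
    0 < (1 : ℝ) * (z₀ / halfDir θ).im := by
  have hz : 0 < ‖z₀‖ := norm_pos_iff.2 hz₀
  rw [div_halfDir_im, ← Real.sin_add_two_pi, one_mul]
  exact mul_pos hz (Real.sin_pos_of_pos_of_lt_pi (by linarith [hθ.2]) (by linarith [hθ.1]))

theorem sq_eq_of_stokes (z₀ : ℂ) (k : ℤ) :
    z₀ ^ 2 = (‖z₀‖ * halfDir (2 * z₀.arg + 2 * Real.pi * k)) ^ 2 := by
  conv_lhs => rw [← Complex.norm_mul_exp_arg_mul_I z₀]
  rw [mul_pow, mul_pow, halfDir_sq, ← Complex.exp_nat_mul]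
  congr 1
  rw [Complex.exp_eq_exp_iff_exists_int]
  exact ⟨-k, by push_cast; ring⟩

/-- Modulo `4π`, every direction is of the form `δ + 2πk` or lies in one of two open intervals of
length `2π`. -/
theorem exists_add_mem_Ioo (δ d : ℝ) (hd : ∀ k : ℤ, d ≠ δ + 2 * Real.pi * k) :
    ∃ k : ℤ, d + 4 * Real.pi * k ∈ Ioo δ (δ + 2 * Real.pi) ∨
      d + 4 * Real.pi * k ∈ Ioo (δ + 2 * Real.pi) (δ + 4 * Real.pi) := by
  obtain ⟨k, ⟨h1, h2⟩, -⟩ :=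
    existsUnique_add_zsmul_mem_Ico (by positivity : (0 : ℝ) < 4 * Real.pi) d δ
  rw [zsmul_eq_mul, mul_comm (k : ℝ)] at h1 h2
  have hne1 : d + 4 * Real.pi * k ≠ δ := fun h => hd (-2 * k) (by push_cast; linarith)
  have hne2 : d + 4 * Real.pi * k ≠ δ + 2 * Real.pi :=
    fun h => hd (-2 * k + 1) (by push_cast; linarith)
  refine ⟨k, ?_⟩
  rcases lt_or_gt_of_ne hne2 with h | h
  · exact Or.inl ⟨lt_of_le_of_ne h1 hne1.symm, h⟩
  · exact Or.inr ⟨h, h2⟩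

theorem line_add_four_pi (φ : ℝ) (k : ℤ) : line (φ + 4 * Real.pi * k) = line φ := by
  simp only [line, surfacePoint_add_four_pi]

theorem line_add_two_pi_int (φ : ℝ) (k : ℤ) :
    line (φ + 2 * Real.pi * k) = line φ ∨ line (φ + 2 * Real.pi * k) = line (φ + 2 * Real.pi) := by
  rcases Int.even_or_odd' k with ⟨m, rfl | rfl⟩
  · left
    rw [← line_add_four_pi φ m]; congr 1; push_cast; ring
  · right
    rw [← line_add_four_pi (φ + 2 * Real.pi) m]; congr 1; push_cast; ring

theorem stokesLines_eq {b : ℕ → ℂ → ℂ} {δ : ℝ}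
    (h : ∀ φ, IsStokesDirection b φ ↔ ∃ k : ℤ, φ = δ + 2 * Real.pi * k) :
    stokesLines b = {line δ, line (δ + 2 * Real.pi)} := by
  ext L
  simp only [stokesLines, h, mem_ofPred_eq, mem_insert_iff, mem_singleton_iff]
  constructor
  · rintro ⟨φ, ⟨k, rfl⟩, rfl⟩
    exact line_add_two_pi_int δ k
  · rintro (rfl | rfl)
    · exact ⟨δ, ⟨0, by simp⟩, rfl⟩
    · exact ⟨_, ⟨1, by simp⟩, rfl⟩

theorem antiStokesLines_eq {b : ℕ → ℂ → ℂ} {δ : ℝ}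
    (h : ∀ φ, IsStokesDirection b φ ↔ ∃ k : ℤ, φ = δ + 2 * Real.pi * k) :
    antiStokesLines b =
        {line (δ + Real.pi / 2), line (δ - Real.pi / 2),
          line (δ + 2 * Real.pi + Real.pi / 2), line (δ + 2 * Real.pi - Real.pi / 2)} := by
  ext L
  simp only [antiStokesLines, h, mem_ofPred_eq, mem_insert_iff, mem_singleton_iff]
  constructor
  · rintro ⟨φ, ⟨k, rfl⟩, rfl | rfl⟩
    · have := line_add_two_pi_int (δ + Real.pi / 2) k
      rw [add_right_comm δ (Real.pi / 2), add_right_comm δ (Real.pi / 2)] at this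
      tauto
    · have := line_add_two_pi_int (δ - Real.pi / 2) k
      rw [sub_add_eq_add_sub, sub_add_eq_add_sub] at this
      tauto
  · have h0 : ∃ k : ℤ, δ = δ + 2 * Real.pi * k := ⟨0, by simp⟩
    have h1 : ∃ k : ℤ, δ + 2 * Real.pi = δ + 2 * Real.pi * k := ⟨1, by simp⟩
    rintro (rfl | rfl | rfl | rfl)
    · exact ⟨_, h0, Or.inl rfl⟩
    · exact ⟨_, h0, Or.inr rfl⟩
    · exact ⟨_, h1, Or.inl rfl⟩
    · exact ⟨_, h1, Or.inr rfl⟩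

theorem isStokesDirection_iff {b : ℕ → ℂ → ℂ} {δ : ℝ}
    (h : ∀ d, IsSummableInDirection b d ↔ ∀ k : ℤ, d ≠ δ + 2 * Real.pi * k) (φ : ℝ) :
    IsStokesDirection b φ ↔ ∃ k : ℤ, φ = δ + 2 * Real.pi * k := by
  have hpi := Real.pi_pos
  constructor
  · rintro ⟨hn, -⟩
    rw [h] at hn
    push Not at hn
    exact hn
  · rintro ⟨k, rfl⟩
    refine ⟨fun hs => (h _).1 hs k rfl, 2 * Real.pi, by positivity, fun d hd hne => (h d).2 ?_⟩
    rintro m rfl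
    have e1 : (k : ℝ) - 1 < m := by nlinarith [hd.1]
    have e2 : (m : ℝ) < k + 1 := by nlinarith [hd.2]
    have e1' : k - 1 < m := by exact_mod_cast e1
    have e2' : m < k + 1 := by exact_mod_cast e2
    exact hne (by rw [show m = k by omega])

/-! ### Maximality -/

theorem isWideSector_surfaceDisc {r : ℝ} (hr : 0 < r) : IsWideSector (surfaceDisc r) := by
  have hpi := Real.pi_pos
  refine ⟨0, 5 * Real.pi, r, by linarith, hr,
    Subset.antisymm ?_ (sector_subset_surfaceDisc 0 (5 * Real.pi) r)⟩
  rintro w ⟨h1, h2⟩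
  obtain ⟨φ, ⟨hφ1, hφ2⟩, hw⟩ := exists_surfacePoint_eq w (-2 * Real.pi)
  rw [norm_pow] at h1 h2
  exact ⟨_, φ, h1, h2, abs_lt.2 ⟨by linarith, by linarith⟩, hw⟩

theorem surfaceDisc_subset_union (δ : ℝ) {ε r : ℝ} (hεpi : ε < Real.pi) :
    surfaceDisc r ⊆ sector (δ + Real.pi) (3 * Real.pi - ε) r ∪
      sector (δ + 3 * Real.pi) (3 * Real.pi - ε) r := by
  have hpi := Real.pi_pos
  rintro w ⟨h1, h2⟩
  obtain ⟨φ, ⟨hφ1, hφ2⟩, hw⟩ := exists_surfacePoint_eq w δ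
  rw [norm_pow] at h1 h2
  rcases lt_or_ge φ (δ + 2 * Real.pi) with h | h
  · exact Or.inl ⟨_, φ, h1, h2, abs_lt.2 ⟨by linarith, by linarith⟩, hw⟩
  · exact Or.inr ⟨_, φ, h1, h2, abs_lt.2 ⟨by linarith, by linarith⟩, hw⟩

theorem surfacePoint_eq_mul_halfDir (x φ : ℝ) :
    surfacePoint x φ = (Real.sqrt x : ℂ) * halfDir φ := rfl

theorem surfacePoint_mem_sector_of_mem {d α R x d' : ℝ} (hx : 0 < x)
    (h : surfacePoint x d' ∈ sector d α R) {y : ℝ} (hy : 0 < y) (hyx : y ≤ x) :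
    surfacePoint y d' ∈ sector d α R := by
  obtain ⟨x', φ, hx', hxR, hφ, heq⟩ := h
  have hxx : x = x' := by
    rw [← norm_surfacePoint_sq hx d', heq, norm_surfacePoint_sq hx']
  subst hxx
  refine ⟨y, φ, hy, hyx.trans_lt hxR, hφ, ?_⟩
  rw [surfacePoint_eq_mul_halfDir, surfacePoint_eq_mul_halfDir] at heq ⊢
  have hs : (Real.sqrt x : ℂ) ≠ 0 := by exact_mod_cast (Real.sqrt_pos.2 hx).ne'
  rw [mul_left_cancel₀ hs heq]

/-- Analytic continuation in both variables: a holomorphic function on a sector which is the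
`1`-sum in some direction coincides with any other representative of that `1`-sum. -/
theorem IsOneSumOn.eqOn {b : ℕ → ℂ → ℂ} {d : ℝ} {V : Set ℂ} {u v : ℂ → ℂ → ℂ} {ρ : ℝ}
    (hV : IsSector V) (hρ : 0 < ρ) (h : IsOneSumOn b d V u) (hu : IsHolomorphicOn u V ρ)
    (hv : IsHolomorphicOn v V ρ) (hvs : IsOneSum b d v) :
    ∀ w ∈ V, ∀ z ∈ disc ρ, u w z = v w z := by
  obtain ⟨⟨_, hwV, x, hx, rfl⟩, s, hs, η, r, ρ₁, hη, hr, hρ₁, heq⟩ := h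
  obtain ⟨r₂, ρ₂, hr₂, hρ₂, heq₂⟩ := hs.eqOn hvs
  obtain ⟨d', α, R, hα, hR, rfl⟩ := hV
  have hpi := Real.pi_pos
  have hVo := isOpen_sector d' α hR
  obtain ⟨y, hy, hyx, hyr, hyr₂⟩ : ∃ y : ℝ, 0 < y ∧ y ≤ x ∧ y < r ∧ y < r₂ := by
    refine ⟨min x (min r r₂) / 2, by positivity, ?_, ?_, ?_⟩
    · have := min_le_left x (min r r₂); linarith
    · have := (min_le_right x (min r r₂)).trans (min_le_left _ _); linarith
    · have := (min_le_right x (min r r₂)).trans (min_le_right _ _); linarith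
  have hyV := surfacePoint_mem_sector_of_mem hx hwV hy hyx
  have hy1 : surfacePoint y d ∈ sector d η r := ⟨y, d, hy, hyr, by simpa using hη, rfl⟩
  have hy2 : surfacePoint y d ∈ sector d (Real.pi / 2) r₂ :=
    ⟨y, d, hy, hyr₂, by simp only [sub_self, abs_zero]; linarith, rfl⟩
  have hsmall : ∀ z, ‖z‖ < min ρ (min ρ₁ ρ₂) → ∀ w ∈ sector d' α R, u w z = v w z := by
    intro z hz
    have z0 : z ∈ disc ρ := by simpa [disc] using hz.trans_le (min_le_left _ _)
    have z1 : z ∈ disc ρ₁ := by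
      simpa [disc] using hz.trans_le ((min_le_right _ _).trans (min_le_left _ _))
    have z2 : z ∈ disc ρ₂ := by
      simpa [disc] using hz.trans_le ((min_le_right _ _).trans (min_le_right _ _))
    refine ((hu.left z0).analyticOnNhd hVo).eqOn_of_preconnected_of_eventuallyEq
      ((hv.left z0).analyticOnNhd hVo) (isPreconnected_sector d' α hR) hyV ?_
    filter_upwards [hVo.mem_nhds hyV, (isOpen_sector d η hr).mem_nhds hy1,
      (isOpen_sector d (Real.pi / 2) hr₂).mem_nhds hy2] with w w0 w1 w2
    rw [heq w ⟨w0, w1⟩ z z1, heq₂ w w2 z z2]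
  intro w hw
  have hDo : IsOpen (disc ρ) := Metric.isOpen_ball
  refine ((hu.right hw).analyticOnNhd hDo).eqOn_of_preconnected_of_eventuallyEq
    ((hv.right hw).analyticOnNhd hDo) (convex_ball (0 : ℂ) ρ).isPreconnected
    (Metric.mem_ball_self hρ) ?_
  filter_upwards [Metric.ball_mem_nhds (0 : ℂ) (by positivity : 0 < min ρ (min ρ₁ ρ₂))] with z hz
  exact hsmall z (by simpa using hz) w hw

end HeatStokes

end

theorem theorem5p2 (a z₀ : ℂ) (ha : a ≠ 0) (hz₀ : z₀ ≠ 0)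
    (φt : ℂ → ℂ) (hφt : IsEntireOfOrderTwo φt)
    (φ : ℂ → ℂ) (hφ : ∀ z, φ z = a / (z - z₀) + φt z)
    (δ : ℝ) (hδ : δ = 2 * Complex.arg z₀)
    (uh : ℕ → ℂ → ℂ) (huh : IsFormalSolution φ uh) :
    ∃ u₁ u₂ : ℂ → ℂ → ℂ,
      (∀ (θ : ℝ) (k : ℤ), θ + 4 * Real.pi * k ∈ Ioo δ (δ + 2 * Real.pi) →
        IsHeatIntegral φ θ u₁ ∧ IsOneSum uh θ u₁) ∧
      (∀ (θ : ℝ) (k : ℤ),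
        θ + 4 * Real.pi * k ∈ Ioo (δ + 2 * Real.pi) (δ + 4 * Real.pi) →
        IsHeatIntegral φ θ u₂ ∧ IsOneSum uh θ u₂) ∧
      (∀ ε : ℝ, 0 < ε → ε < Real.pi → ∃ r ρ₀ : ℝ, 0 < r ∧ 0 < ρ₀ ∧
        ∀ ρ : ℝ, 0 < ρ → ρ ≤ ρ₀ →
          IsHolomorphicOn u₁ (sector (δ + Real.pi) (3 * Real.pi - ε) r) ρ ∧
          IsHolomorphicOn u₂ (sector (δ + 3 * Real.pi) (3 * Real.pi - ε) r) ρ ∧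
          IsMaximalFamily φ uh (surfaceDisc r) ρ
            ![sector (δ + Real.pi) (3 * Real.pi - ε) r,
              sector (δ + 3 * Real.pi) (3 * Real.pi - ε) r] ![u₁, u₂] ∧
          (∀ w ∈ sector δ (Real.pi - ε) r, ∀ z ∈ disc ρ,
            u₁ w z - u₂ w z =
              -Complex.I * ((Real.sqrt Real.pi : ℂ) / w) * a *
                Complex.exp (-(z₀ - z) ^ 2 / (4 * w ^ 2))) ∧
          IsJump uh δ (Real.pi - ε) r ρ (fun w z =>
            -Complex.I * ((Real.sqrt Real.pi : ℂ) / w) * a *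
              Complex.exp (-(z₀ - z) ^ 2 / (4 * w ^ 2))) ∧
          (∀ w ∈ sector (δ + 2 * Real.pi) (Real.pi - ε) r, ∀ z ∈ disc ρ,
            u₂ w z - u₁ w z =
              Complex.I * ((Real.sqrt Real.pi : ℂ) / w) * a *
                Complex.exp (-(z₀ - z) ^ 2 / (4 * w ^ 2))) ∧
          IsJump uh (δ + 2 * Real.pi) (Real.pi - ε) r ρ (fun w z =>
            Complex.I * ((Real.sqrt Real.pi : ℂ) / w) * a *
              Complex.exp (-(z₀ - z) ^ 2 / (4 * w ^ 2)))) ∧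
      stokesLines uh = {line δ, line (δ + 2 * Real.pi)} ∧
      antiStokesLines uh =
        {line (δ + Real.pi / 2), line (δ - Real.pi / 2),
          line (δ + 2 * Real.pi + Real.pi / 2), line (δ + 2 * Real.pi - Real.pi / 2)} := by
  have hpi := Real.pi_pos
  subst hδ
  -- the sign conditions, for directions modulo `4π`
  have hneg : ∀ (θ : ℝ) (k : ℤ),
      θ + 4 * Real.pi * k ∈ Ioo (2 * z₀.arg) (2 * z₀.arg + 2 * Real.pi) →
      0 < (-1 : ℝ) * (z₀ / halfDir θ).im := fun θ k h => by
    rw [← halfDir_add_four_pi θ k]; exact im_neg_of_mem hz₀ h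
  have hpos : ∀ (θ : ℝ) (k : ℤ),
      θ + 4 * Real.pi * k ∈ Ioo (2 * z₀.arg + 2 * Real.pi) (2 * z₀.arg + 4 * Real.pi) →
      0 < (1 : ℝ) * (z₀ / halfDir θ).im := fun θ k h => by
    rw [← halfDir_add_four_pi θ k]; exact im_pos_of_mem hz₀ h
  have hs1 : (-1 : ℝ) = 1 ∨ (-1 : ℝ) = -1 := Or.inr rfl
  have hs2 : (1 : ℝ) = 1 ∨ (1 : ℝ) = -1 := Or.inl rfl
  have hsum₁ : ∀ (θ : ℝ) (k : ℤ),
      θ + 4 * Real.pi * k ∈ Ioo (2 * z₀.arg) (2 * z₀.arg + 2 * Real.pi) →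
      IsOneSum uh θ (heatSol (-1) φt a z₀) := fun θ k h =>
    isOneSum_heatSol hφt hz₀ hφ huh hs1 (hneg θ k h)
  have hsum₂ : ∀ (θ : ℝ) (k : ℤ),
      θ + 4 * Real.pi * k ∈ Ioo (2 * z₀.arg + 2 * Real.pi) (2 * z₀.arg + 4 * Real.pi) →
      IsOneSum uh θ (heatSol 1 φt a z₀) := fun θ k h =>
    isOneSum_heatSol hφt hz₀ hφ huh hs2 (hpos θ k h)
  have hsummable : ∀ d, IsSummableInDirection uh d ↔
      ∀ k : ℤ, d ≠ 2 * z₀.arg + 2 * Real.pi * k := by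
    intro d
    constructor
    · rintro hd k rfl
      exact not_isSummableInDirection hφt ha hz₀ hφ huh (sq_eq_of_stokes z₀ k) hd
    · intro hd
      obtain ⟨k, hk | hk⟩ := exists_add_mem_Ioo _ d hd
      · exact (hsum₁ d k hk).isSummableInDirection
      · exact (hsum₂ d k hk).isSummableInDirection
  have hstokes := isStokesDirection_iff hsummable
  refine ⟨heatSol (-1) φt a z₀, heatSol 1 φt a z₀,
    fun θ k h => ⟨isHeatIntegral_heatSol hφt hφ hs1 (hneg θ k h), hsum₁ θ k h⟩,
    fun θ k h => ⟨isHeatIntegral_heatSol hφt hφ hs2 (hpos θ k h), hsum₂ θ k h⟩, ?_,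
    stokesLines_eq hstokes, antiStokesLines_eq hstokes⟩
  intro ε hε hεpi
  obtain ⟨r, hr, hreg⟩ := exists_heatSol_holomorphic hφt
  obtain ⟨hh1, he1, hl1⟩ := hreg (-1) a z₀
  obtain ⟨hh2, he2, hl2⟩ := hreg 1 a z₀
  obtain ⟨ρ₁, hρ₁, hact1⟩ := exists_isActualSolution hφ hh1 he1 hl1 hs1
    (β := 2 * z₀.arg + Real.pi)
    (fun θ hθ => hneg θ 0 (by simp only [Int.cast_zero, mul_zero, add_zero]
                              exact ⟨by linarith [hθ.1], by linarith [hθ.2]⟩)) hε hεpi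
  obtain ⟨ρ₂, hρ₂, hact2⟩ := exists_isActualSolution hφ hh2 he2 hl2 hs2
    (β := 2 * z₀.arg + 3 * Real.pi)
    (fun θ hθ => hpos θ 0 (by simp only [Int.cast_zero, mul_zero, add_zero]
                              exact ⟨by linarith [hθ.1], by linarith [hθ.2]⟩)) hε hεpi
  refine ⟨r, min (min ρ₁ ρ₂) 1, hr, by positivity, fun ρ hρ hρle => ?_⟩
  have l1 : ρ ≤ ρ₁ := hρle.trans ((min_le_left _ _).trans (min_le_left _ _))
  have l2 : ρ ≤ ρ₂ := hρle.trans ((min_le_left _ _).trans (min_le_right _ _))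
  have l3 : disc ρ ⊆ disc 1 := Metric.ball_subset_ball (hρle.trans (min_le_right _ _))
  have hhol1 : ∀ V ⊆ surfaceDisc r, IsHolomorphicOn (heatSol (-1) φt a z₀) V ρ :=
    fun V hV => hh1.mono (prod_mono hV l3)
  have hhol2 : ∀ V ⊆ surfaceDisc r, IsHolomorphicOn (heatSol 1 φt a z₀) V ρ :=
    fun V hV => hh2.mono (prod_mono hV l3)
  have hsub := fun d α => sector_subset_surfaceDisc d α r
  have hjump : ∀ w z, heatSol 1 φt a z₀ w z - heatSol (-1) φt a z₀ w z =
      Complex.I * ((Real.sqrt Real.pi : ℂ) / w) * a *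
        Complex.exp (-(z₀ - z) ^ 2 / (4 * w ^ 2)) := by
    intro w z
    rw [← neg_sub, heatSol_sub_heatSol]
    ring
  have hne : ∀ w ∈ surfaceDisc r, ∀ z, heatSol (-1) φt a z₀ w z ≠ heatSol 1 φt a z₀ w z := by
    intro w hw z h
    have hw0 : w ≠ 0 := by rintro rfl; simpa using hw.1
    have h1 := hjump w z
    rw [h, sub_self] at h1
    have hsp : (Real.sqrt Real.pi : ℂ) ≠ 0 := by
      exact_mod_cast (Real.sqrt_pos.2 Real.pi_pos).ne'
    exact mul_ne_zero (mul_ne_zero (mul_ne_zero Complex.I_ne_zero (div_ne_zero hsp hw0)) ha)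
      (Complex.exp_ne_zero _) h1.symm
  refine ⟨hhol1 _ (hsub _ _), hhol2 _ (hsub _ _), ?_, fun w _ z _ => heatSol_sub_heatSol _ _ _ _ _,
    ?_, fun w _ z _ => hjump w z, ?_⟩
  · refine ⟨huh, ⟨{2 * z₀.arg}, fun d hd => ?_⟩, isWideSector_surfaceDisc hr, ?_, ?_, ?_, ?_, ?_⟩
    · rw [hsummable] at hd
      push Not at hd
      exact ⟨_, Finset.mem_singleton_self _, hd⟩
    · rw [Fin.forall_fin_two]
      exact ⟨⟨⟨_, _, r, by linarith, hr, rfl⟩, hsub _ _⟩,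
        ⟨⟨_, _, r, by linarith, hr, rfl⟩, hsub _ _⟩⟩
    · intro w hw
      rcases surfaceDisc_subset_union (2 * z₀.arg) hεpi hw with h | h
      · exact mem_iUnion.2 ⟨0, h⟩
      · exact mem_iUnion.2 ⟨1, h⟩
    · rw [Fin.forall_fin_two]
      exact ⟨hact1 ρ l1, hact2 ρ l2⟩
    · intro i j hij ⟨w, hwi, hwj⟩
      refine ⟨w, ⟨hwi, hwj⟩, 0, Metric.mem_ball_self hρ, ?_⟩
      fin_cases i <;> fin_cases j
      · exact absurd rfl hij
      · exact hne w (hsub _ _ hwi) 0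
      · exact (hne w (hsub _ _ hwj) 0).symm
      · exact absurd rfl hij
    · intro V' u' d hV' hV'sub hact hd hone
      obtain ⟨w, hwV, x, hx, hwx⟩ := hone.1
      have hxr : x < r := by
        have := (hV'sub hwV).2
        rwa [hwx, norm_pow, norm_surfacePoint_sq hx] at this
      obtain ⟨k, hk | hk⟩ := exists_add_mem_Ioo _ d ((hsummable d).1 hd)
      · refine ⟨0, ⟨w, hwV, ?_⟩, fun w hw z hz => ?_⟩
        · rw [hwx, ← surfacePoint_add_four_pi x d k]
          exact ⟨x, _, hx, hxr, abs_lt.2 ⟨by linarith [hk.1], by linarith [hk.2]⟩, rfl⟩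
        · exact hone.eqOn hV' hρ hact.holomorphic (hhol1 _ hV'sub) (hsum₁ d k hk) w hw.1 z hz
      · refine ⟨1, ⟨w, hwV, ?_⟩, fun w hw z hz => ?_⟩
        · rw [hwx, ← surfacePoint_add_four_pi x d k]
          exact ⟨x, _, hx, hxr, abs_lt.2 ⟨by linarith [hk.1], by linarith [hk.2]⟩, rfl⟩
        · exact hone.eqOn hV' hρ hact.holomorphic (hhol2 _ hV'sub) (hsum₂ d k hk) w hw.1 z hz
  · refine ⟨(hstokes _).2 ⟨0, by simp⟩, _, _, hhol1 _ (hsub _ _), hhol2 _ (hsub _ _),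
      ⟨Real.pi, hpi, fun d hd => hsum₁ d 0 ?_, fun d hd => hsum₂ d 1 ?_⟩,
      fun w _ z _ => heatSol_sub_heatSol _ _ _ _ _⟩
    · simp only [Int.cast_zero, mul_zero, add_zero]
      exact ⟨hd.1, by linarith [hd.2]⟩
    · simp only [Int.cast_one, mul_one]
      exact ⟨by linarith [hd.1], by linarith [hd.2]⟩
  · refine ⟨(hstokes _).2 ⟨1, by simp⟩, _, _, hhol2 _ (hsub _ _), hhol1 _ (hsub _ _),
      ⟨Real.pi, hpi, fun d hd => hsum₂ d 0 ?_, fun d hd => hsum₁ d 0 ?_⟩,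
      fun w _ z _ => hjump w z⟩
    · simp only [Int.cast_zero, mul_zero, add_zero]
      exact ⟨hd.1, by linarith [hd.2]⟩
    · simp only [Int.cast_zero, mul_zero, add_zero]
      exact ⟨by linarith [hd.1], hd.2⟩
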